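/- **Language.** Predicate types are $\pi ::= o \mid \rho\to\pi$ and argument types are $\rho ::= \iota \mid \pi$. Expressions are built from typed variables, individual constants (of type $\iota$) and predicate constants by application; literals are $\mathsf E$, $\mathrm{not}\,\mathsf E$ (for $\mathsf E$ of type $o$), $\mathsf E_1\approx \mathsf E_2$ and $\mathrm{not}(\mathsf E_1\approx \mathsf E_2)$ (for $\mathsf E_1,\mathsf E_2$ of type $\iota$). A program $\mathsf P$ of Higher-Order Datalog$^\neg$ is a finite set of rules $\mathsf p\,\mathsf R_1\cdots\mathsf R_n\leftarrow \mathsf L_1\wedge\dots\wedge\mathsf L_m$, where $\mathsf p$ is a predicate constant, the $\mathsf R_i$ are distinct variables of the argument types of $\mathsf p$, and the $\mathsf L_j$ are literals. **Semantics.** Let $U_{\mathsf P}$ be the set of individual constants of $\mathsf P$, and put $[\![\iota]\!]=U_{\mathsf P}$, $[\![o]\!]=\{\mathit{false}<\mathit{true}\}$, and $[\![\rho\to\pi]\!]$ the set of all functions $[\![\rho]\!]\to[\![\pi]\!]$, ordered pointwise ($[\![\iota]\!]$ is ordered trivially). An interpretation maps each predicate constant of type $\pi$ to an element of $[\![\pi]\!]$;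 a state $s$ maps each variable of type $\rho$ to an element of $[\![\rho]\!]$. For interpretations $I\le J$ and a state $s$, expressions and bodies are evaluated to pairs: variables and individual constants to $(v,v)$ with $v$ their value; $\mathsf p$ to $(I(\mathsf p),J(\mathsf p))$; $(\mathsf E_1\,\mathsf E_2)$ to $\big(\bigwedge_{l\le d\le u} f(d),\bigvee_{l\le d\le u} g(d)\big)$ if $\mathsf E_1,\mathsf E_2$ evaluate to $(f,g),(l,u)$; equalities to $(b,b)$ with $b$ their truth value; the negation of a literal of value $(a,b)$ to $(\neg b,\neg a)$; conjunctions componentwise. The operator $A_{\mathsf P}$ maps $(I,J)$ to the pair of interpretations with $A_{\mathsf P}(I,J)_i(\mathsf p)(\bar d)$ the disjunction, over all rules $\mathsf p\,\bar{\mathsf R}\leftarrow\mathsf B$ of $\mathsf P$ and all states $s$, of the $i$-th component of the value of $\mathsf B$ in the state $s[\bar{\mathsf R}/\bar d]$. The pair $(I,J)$, $I\le J$, is a three-valued stable model if $I$ is the least fixpoint of $A_{\mathsf P}(\cdot,J)_1$ (among the interpretations $\le J$) and $J$ is the least fixpoint of $A_{\mathsf P}(I,\cdot)_2$ (among the interpretations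 $\ge I$). It is a stable model if moreover $I=J$. It is the well-founded model if $I\le I'$ and $J'\le J$ for every three-valued stable model $(I',J')$. An atom is true in $(I,J)$ if it is true in $I$. **Queries.** A database schema is a finite set of first-order predicate symbols with arities, a database over it is a finite set of ground atoms over it, and a query is a map from databases over a schema $\sigma_1$ to databases over a schema $\sigma_2$. The program $\mathsf P$ defines the query $\mathcal Q$ under the well-founded semantics (resp. the stable semantics with cautious reasoning, with brave reasoning) if for every database $D$ over $\sigma_1$ the set $\mathcal Q(D)$ consists of the ground atoms over $\sigma_2$ with constants in $U_{\mathsf P\cup D}$ that are true in the well-founded model (resp. in all stable models, in at least one stable model) of $\mathsf P\cup D$. **Transformation.** Let $\mathsf p\,\bar{\mathsf X}\leftarrow\mathsf B$ be a rule of $\mathsf P$, and let $\mathsf R\notin\bar{\mathsf X}$ be a predicate variable (occurring in $\mathsf B$), of type $\rho_{\mathsf R}=\rho_1\to\cdots\to\rho_n\to o$, $n\ge 0$. Let $\mathsf P'$ be $\mathsf P$ with this rule replaced by the rules $$\begin{aligned} &\mathsf p\,\bar{\mathsf X}\leftarrow \mathrm{test}\,\bar{\mathsf X}\,\mathrm{empty},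 \qquad \mathrm{test}\,\bar{\mathsf X}\,\mathsf R\leftarrow\mathsf B,\qquad \mathrm{test}\,\bar{\mathsf X}\,\mathsf R\leftarrow \mathrm{test}\,\bar{\mathsf X}\,(\mathrm{add}\,\mathsf R\,\mathsf Z_1\cdots\mathsf Z_n),\\ &\mathrm{empty}\,\mathsf Y_1\cdots\mathsf Y_n\leftarrow \mathrm{false},\qquad \mathrm{add}\,\mathsf R\,\bar{\mathsf Z}\,\bar{\mathsf Y}\leftarrow \mathsf R\,\bar{\mathsf Y},\qquad \mathrm{add}\,\mathsf R\,\bar{\mathsf Z}\,\bar{\mathsf Y}\leftarrow \mathrm{eq}_{\rho_1}\mathsf Z_1\mathsf Y_1,\dots,\mathrm{eq}_{\rho_n}\mathsf Z_n\mathsf Y_n, \end{aligned}$$ and, for each $\rho\in\{\rho_1,\dots,\rho_n\}$, the rule $\mathrm{eq}_\iota\,\mathsf Z\,\mathsf Y\leftarrow \mathsf Z\approx\mathsf Y$ if $\rho=\iota$, and otherwise the rules $\mathrm{eq}_\rho\,\mathsf Z\,\mathsf Y\leftarrow\mathrm{not}(\mathrm{neq}_\rho\,\mathsf Z\,\mathsf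 Y)$, $\ \mathrm{neq}_\rho\,\mathsf Z\,\mathsf Y\leftarrow \mathsf Z\,\bar{\mathsf V},\mathrm{not}(\mathsf Y\,\bar{\mathsf V})$, $\ \mathrm{neq}_\rho\,\mathsf Z\,\mathsf Y\leftarrow \mathrm{not}(\mathsf Z\,\bar{\mathsf V}),\mathsf Y\,\bar{\mathsf V}$. Within each rule the displayed variables are distinct; $\mathrm{false}$ stands for a body that is always false, such as $\mathrm{not}(\mathsf W\approx \mathsf W)$. The predicate constants test, empty, add, $\mathrm{eq}_\rho$, $\mathrm{neq}_\rho$ are distinct and occur neither in $\mathsf P$ nor in the schemas $\sigma_1,\sigma_2$. If $\rho_{\mathsf R}=o$, one may alternatively first replace each occurrence of $\mathsf R$ in $\mathsf B$ by $\mathsf F\,\mathsf W$, where $\mathsf F$ of type $\iota\to o$ and $\mathsf W$ of type $\iota$ are fresh variables, and then apply the transformation with $\mathsf F$ in place of $\mathsf R$. **Theorem.** Let $\mathsf P'$ result from the program $\mathsf P$ by the above transformation, and let $\mathcal Q$ be a query. Then $\mathsf P$ defines $\mathcal Q$ under the well-founded semantics (resp. the stable semantics with cautious reasoning, the stable semantics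 with brave reasoning) if and only if $\mathsf P'$ does. -/

import Mathlib

namespace HODatalog

/-! ## Types -/

mutual

/-- Predicate types `π := o | ρ → π`. -/
inductive PTy : Type
  | o : PTy
  | arr : ATy → PTy → PTy

/-- Argument types `ρ := ι | π`. -/
inductive ATy : Type
  | iota : ATy
  | pred : PTy → ATy

end

/-- `(ρ₁ → ⋯ → ρₙ → o).append π = ρ₁ → ⋯ → ρₙ → π`. -/
def PTy.append : PTy → PTy → PTy
  | .o, π => π
  | .arr ρ π', π => .arr ρ (PTy.append π' π)

/-- The list `ρ₁, …, ρₙ` of argument types of `ρ₁ → ⋯ → ρₙ → o`. -/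
def PTy.args : PTy → List ATy
  | .o => []
  | .arr ρ π => ρ :: PTy.args π

/-- The first-order predicate type `ι → ⋯ → ι → o` of arity `n`. -/
def PTy.fo : ℕ → PTy
  | 0 => .o
  | n + 1 => .arr .iota (PTy.fo n)

/-! ## Syntax

`C` is the set of individual constants and `N` the set of names of predicate constants.
A predicate constant is a name together with a predicate type; a variable is a number
together with an argument type. -/

/-- Expressions, by type. -/
inductive Expr (C N : Type) : ATy → Type
  | var (ρ : ATy) (x : ℕ) : Expr C N ρ
  | cst (c : C) : Expr C N .iota
  | sym (π : PTy) (p : N) : Expr C N (.pred π)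
  | app {ρ : ATy} {π : PTy} (E : Expr C N (.pred (.arr ρ π))) (F : Expr C N ρ) :
      Expr C N (.pred π)

/-- Literals: `E`, `not E`, `E ≈ F` and `not (E ≈ F)`. -/
inductive Lit (C N : Type) : Type
  | pos (E : Expr C N (.pred .o)) : Lit C N
  | neg (E : Expr C N (.pred .o)) : Lit C N
  | eq (E F : Expr C N .iota) : Lit C N
  | neq (E F : Expr C N .iota) : Lit C N

/-- `Params (ρ₁ → ⋯ → ρₙ → o)`: sequences of variables `R₁ ⋯ Rₙ` of types `ρ₁, …, ρₙ`. -/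
inductive Params : PTy → Type
  | nil : Params .o
  | cons {ρ : ATy} {π : PTy} (x : ℕ) (X : Params π) : Params (.arr ρ π)

/-- The variables in a sequence. -/
def Params.vars : {π : PTy} → Params π → List (ATy × ℕ)
  | _, .nil => []
  | .arr ρ _, .cons x X => (ρ, x) :: X.vars

/-- A rule `p R₁ ⋯ Rₙ ← L₁ ∧ ⋯ ∧ Lₘ` with distinct variables `Rᵢ`. -/
structure Rule (C N : Type) where
  ty : PTy
  name : N
  params : Params ty
  nodup : params.vars.Nodup
  body : List (Lit C N)

/-- A program is a finite set of rules. -/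
abbrev Program (C N : Type) := Finset (Rule C N)

section Occurrences

variable {C N : Type}

/-- The individual constants that occur in an expression. -/
def Expr.consts : {ρ : ATy} → Expr C N ρ → Set C
  | _, .var _ _ => ∅
  | _, .cst c => {c}
  | _, .sym _ _ => ∅
  | _, .app E F => E.consts ∪ F.consts

/-- The predicate constants that occur in an expression. -/
def Expr.syms : {ρ : ATy} → Expr C N ρ → Set (PTy × N)
  | _, .var _ _ => ∅
  | _, .cst _ => ∅
  | _, .sym π p => {(π, p)}
  | _, .app E F => E.syms ∪ F.syms

/-- The variables that occur in an expression. -/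
def Expr.vars : {ρ : ATy} → Expr C N ρ → Set (ATy × ℕ)
  | _, .var ρ x => {(ρ, x)}
  | _, .cst _ => ∅
  | _, .sym _ _ => ∅
  | _, .app E F => E.vars ∪ F.vars

def Lit.consts : Lit C N → Set C
  | .pos E => E.consts
  | .neg E => E.consts
  | .eq E F => E.consts ∪ F.consts
  | .neq E F => E.consts ∪ F.consts

def Lit.syms : Lit C N → Set (PTy × N)
  | .pos E => E.syms
  | .neg E => E.syms
  | .eq E F => E.syms ∪ F.syms
  | .neq E F => E.syms ∪ F.syms

def Lit.vars : Lit C N → Set (ATy × ℕ)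
  | .pos E => E.vars
  | .neg E => E.vars
  | .eq E F => E.vars ∪ F.vars
  | .neq E F => E.vars ∪ F.vars

def Rule.consts (r : Rule C N) : Set C := {c | ∃ L ∈ r.body, c ∈ L.consts}

def Rule.syms (r : Rule C N) : Set (PTy × N) :=
  {(r.ty, r.name)} ∪ {q | ∃ L ∈ r.body, q ∈ L.syms}

def Rule.vars (r : Rule C N) : Set (ATy × ℕ) :=
  {v | v ∈ r.params.vars} ∪ {v | ∃ L ∈ r.body, v ∈ L.vars}

/-- The Herbrand universe: the individual constants that occur in the program. -/
def Program.consts (P : Program C N) : Set C := {c | ∃ r ∈ P, c ∈ r.consts}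

def Program.syms (P : Program C N) : Set (PTy × N) := {q | ∃ r ∈ P, q ∈ r.syms}

end Occurrences

/-! ## Two-valued meanings of types -/

mutual

/-- The set of two-valued objects of a predicate type over the universe `U`. -/
def PTy.sem (U : Type) : PTy → Type
  | .o => Prop
  | .arr ρ π => ATy.sem U ρ → PTy.sem U π

/-- The set of two-valued objects of an argument type over the universe `U`. -/
def ATy.sem (U : Type) : ATy → Type
  | .iota => U
  | .pred π => PTy.sem U π

end

/-- `false < true` on `o`, and the pointwise order on function types. -/
noncomputable instance PTy.instCompleteLattice (U : Type) :
    (π : PTy) → CompleteLattice (PTy.sem U π)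
  | .o => inferInstanceAs (CompleteLattice Prop)
  | .arr ρ π =>
    @Pi.instCompleteLattice (ATy.sem U ρ) (fun _ => PTy.sem U π)
      (fun _ => PTy.instCompleteLattice U π)

/-- The order on argument types, which is trivial on `ι`. -/
noncomputable instance ATy.instPartialOrder (U : Type) : (ρ : ATy) → PartialOrder (ATy.sem U ρ)
  | .iota =>
    { le := fun a b => a = b
      le_refl := fun _ => rfl
      le_trans := fun _ _ _ h h' => h.trans h'
      le_antisymm := fun _ _ h _ => h }
  | .pred π => (PTy.instCompleteLattice U π).toPartialOrder

/-- Tuples of arguments for a predicate of type `π`. -/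
def PTy.Tuple (U : Type) : PTy → Type
  | .o => Unit
  | .arr ρ π => ATy.sem U ρ × PTy.Tuple U π

/-- The element of `PTy.sem U π` given by a set of tuples. -/
def PTy.ofSet {U : Type} : (π : PTy) → (PTy.Tuple U π → Prop) → PTy.sem U π
  | .o, S => S ()
  | .arr _ π, S => fun d => PTy.ofSet π fun e => S (d, e)

/-! ## Semantics

A three-valued interpretation is represented by the pair `(I, J)`, `I ≤ J`, of two-valued ones
that corresponds to it: an atom is true if it is true in `I`, false if it is false in `J`, and
undefined otherwise. -/

/-- Two-valued Herbrand interpretations of the predicate constants. -/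
abbrev Interp (U N : Type) := (π : PTy) → N → PTy.sem U π

/-- Herbrand states. -/
abbrev State (U : Type) := (ρ : ATy) → ℕ → ATy.sem U ρ

section Semantics

variable {C N : Type} {U : Set C}

/-- The pair semantics of expressions. In the semantics of a program, `U` contains every constant
that occurs in it, so that the default value for `c ∉ U` is never used. -/
noncomputable def Expr.eval (I J : Interp U N) (s : State U) :
    {ρ : ATy} → Expr C N ρ → ATy.sem U ρ × ATy.sem U ρ
  | _, .var ρ x => (s ρ x, s ρ x)
  | _, .cst c =>
    open Classical in
    let v : ATy.sem U .iota := if h : c ∈ U then (⟨c, h⟩ : U) else s .iota 0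
    (v, v)
  | _, .sym π p => (I π p, J π p)
  | _, @Expr.app _ _ ρ π E F =>
    let f : ATy.sem U ρ → PTy.sem U π := (E.eval I J s).1
    let g : ATy.sem U ρ → PTy.sem U π := (E.eval I J s).2
    let v : PTy.sem U π × PTy.sem U π :=
      (⨅ d ∈ Set.Icc (F.eval I J s).1 (F.eval I J s).2, f d,
        ⨆ d ∈ Set.Icc (F.eval I J s).1 (F.eval I J s).2, g d)
    v

/-- The pair semantics of literals. -/
noncomputable def Lit.eval (I J : Interp U N) (s : State U) : Lit C N → Prop × Prop
  | .pos E => let v : Prop × Prop := E.eval I J s; v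
  | .neg E => let v : Prop × Prop := E.eval I J s; (¬ v.2, ¬ v.1)
  | .eq E F => (E.eval I J s = F.eval I J s, E.eval I J s = F.eval I J s)
  | .neq E F => (¬ E.eval I J s = F.eval I J s, ¬ E.eval I J s = F.eval I J s)

/-- The pair semantics of bodies. -/
noncomputable def bodyEval (I J : Interp U N) (s : State U) (B : List (Lit C N)) : Prop × Prop :=
  (∀ L ∈ B, (L.eval I J s).1, ∀ L ∈ B, (L.eval I J s).2)

/-- The tuple of values of a sequence of variables in a state. -/
def Params.eval {U : Type} (s : State U) : {π : PTy} → Params π → PTy.Tuple U π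
  | _, .nil => ()
  | .arr ρ _, .cons x X => (s ρ x, X.eval s)

/-- The approximating operator `(I, J) ↦ (A(I, J)₁, A(I, J)₂)` of a program. As the variables of a
head are distinct, the states `s[R₁/d₁, …, Rₙ/dₙ]` are those whose values at the `Rᵢ` are the
`dᵢ`. -/
noncomputable def Program.approx (P : Program C N) (U : Set C) (I J : Interp U N) :
    Interp U N × Interp U N :=
  (fun π p => PTy.ofSet π fun d => ∃ X h B, (⟨π, p, X, h, B⟩ : Rule C N) ∈ P ∧
      ∃ s : State U, X.eval s = d ∧ (bodyEval I J s B).1,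
    fun π p => PTy.ofSet π fun d => ∃ X h B, (⟨π, p, X, h, B⟩ : Rule C N) ∈ P ∧
      ∃ s : State U, X.eval s = d ∧ (bodyEval I J s B).2)

end Semantics

/-- `(I, J)` is a stable fixpoint of an operator `A` on the consistent pairs: `I` is the least
fixpoint of `A(·, J)₁` (on the elements below `J`) and `J` is the least fixpoint of `A(I, ·)₂`
(on the elements above `I`). -/
def IsStableFixpoint {L : Type*} [Preorder L] (A : L → L → L × L) (I J : L) : Prop :=
  I ≤ J ∧ IsLeast {x | x ≤ J ∧ (A x J).1 = x} I ∧ IsLeast {y | I ≤ y ∧ (A I y).2 = y} J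

section Models

variable {C N : Type}

/-- Three-valued stable models. -/
def Program.IsStable3 (P : Program C N) (I J : Interp P.consts N) : Prop :=
  IsStableFixpoint (P.approx P.consts) I J

/-- Stable models. -/
def Program.IsStable (P : Program C N) (I : Interp P.consts N) : Prop := P.IsStable3 I I

/-- The well-founded model: the three-valued stable model with the least information. -/
def Program.IsWellFounded (P : Program C N) (I J : Interp P.consts N) : Prop :=
  P.IsStable3 I J ∧ ∀ I' J', P.IsStable3 I' J' → I ≤ I' ∧ J' ≤ J

end Models

/-! ## Databases and queries -/

/-- A ground atom `p(a₁, …, aₙ)`. -/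
structure GroundAtom (C N : Type) where
  name : N
  args : List C

/-- A finite set of first-order predicate symbols with their arities. -/
abbrev Schema (N : Type) := Finset (N × ℕ)

def Schema.syms {N : Type} (σ : Schema N) : Set (PTy × N) :=
  {q | ∃ a ∈ σ, q = (PTy.fo a.2, a.1)}

/-- Databases over a schema: finite sets of ground atoms. -/
abbrev Database (C : Type) {N : Type} (σ : Schema N) :=
  {D : Finset (GroundAtom C N) // ∀ a ∈ D, (a.name, a.args.length) ∈ σ}

/-- Queries. -/
abbrev Query (C : Type) {N : Type} (σ₁ σ₂ : Schema N) := Database C σ₁ → Database C σ₂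

/-- The variables numbered `k, k + 1, …`, with the types given by `π`. -/
def Params.enum : (π : PTy) → ℕ → Params π
  | .o, _ => .nil
  | .arr _ π, k => .cons k (Params.enum π (k + 1))

theorem Params.map_snd_vars_enum : ∀ (π : PTy) (k : ℕ),
    (Params.enum π k).vars.map Prod.snd = List.range' k π.args.length
  | .o, _ => rfl
  | .arr ρ π, k => by
    simp [Params.enum, Params.vars, PTy.args, Params.map_snd_vars_enum π (k + 1),
      List.range'_succ]

theorem Params.nodup_enum (π : PTy) (k : ℕ) : (Params.enum π k).vars.Nodup := by
  refine List.Nodup.of_map Prod.snd ?_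
  rw [Params.map_snd_vars_enum]
  exact List.nodup_range'

section Facts

variable {C N : Type}

/-- The literals `X_k ≈ a₁, X_{k+1} ≈ a₂, …`. -/
def argLits : ℕ → List C → List (Lit C N)
  | _, [] => []
  | k, a :: as => .eq (.var .iota k) (.cst a) :: argLits (k + 1) as

/-- The fact `p(a₁, …, aₙ)`, as the rule `p X₁ ⋯ Xₙ ← X₁ ≈ a₁ ∧ ⋯ ∧ Xₙ ≈ aₙ`. -/
def GroundAtom.toRule (a : GroundAtom C N) : Rule C N where
  ty := PTy.fo a.args.length
  name := a.name
  params := Params.enum _ 0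
  nodup := Params.nodup_enum _ _
  body := argLits 0 a.args

open Classical in
/-- The program `P ∪ D`. -/
noncomputable def Program.addDatabase {σ : Schema N} (P : Program C N) (D : Database C σ) :
    Program C N :=
  P ∪ D.1.image GroundAtom.toRule

/-- The application of a first-order relation to arguments. -/
def applyFO {U : Type} : (as : List U) → PTy.sem U (PTy.fo as.length) → Prop
  | [], f => f
  | a :: as, f => applyFO as (f a)

/-- The ways to read off the output database from the models of a program. -/
inductive Reading
  | wellFounded
  | cautious
  | brave

/-- The ground atom `p(a₁, …, aₙ)` over the Herbrand universe of `P` is true in the well-founded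
model, in all stable models, or in some stable model. -/
def Program.Derives (P : Program C N) (p : N) (as : List P.consts) : Reading → Prop
  | .wellFounded => ∃ I J, P.IsWellFounded I J ∧ applyFO as (I (PTy.fo as.length) p)
  | .cautious => ∀ I, P.IsStable I → applyFO as (I (PTy.fo as.length) p)
  | .brave => ∃ I, P.IsStable I ∧ applyFO as (I (PTy.fo as.length) p)

/-- `P` defines the query `Q`: on every input `D`, the output `Q D` consists of the ground atoms
over the output schema and the Herbrand universe of `P ∪ D` that `P ∪ D` derives. -/
def Program.Defines {σ₁ σ₂ : Schema N} (P : Program C N) (S : Reading) (Q : Query C σ₁ σ₂) :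
    Prop :=
  ∀ (D : Database C σ₁) (a : GroundAtom C N), a ∈ (Q D).1 ↔
    (a.name, a.args.length) ∈ σ₂ ∧ ∃ as : List (P.addDatabase D).consts,
      as.map Subtype.val = a.args ∧ (P.addDatabase D).Derives a.name as S

end Facts

/-! ## The transformation -/

def Params.append : {π π' : PTy} → Params π → Params π' → Params (π.append π')
  | _, _, .nil, Y => Y
  | _, _, .cons x X, Y => .cons x (X.append Y)

theorem Params.vars_append : ∀ {π π' : PTy} (X : Params π) (Y : Params π'),
    (X.append Y).vars = X.vars ++ Y.vars
  | _, _, .nil, _ => rfl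
  | _, _, .cons _ X, Y => congrArg (List.cons _) (Params.vars_append X Y)

/-- A number above the numbers of all variables of a sequence. -/
def Params.bound : {π : PTy} → Params π → ℕ
  | _, .nil => 0
  | _, .cons x X => max (x + 1) X.bound

/-- Names for the new predicates. A name is used with several types, one predicate for each. -/
structure AuxNames (N : Type) where
  test : N
  empty : N
  add : N
  eq : N
  neq : N
  nodup : [test, empty, add, eq, neq].Nodup

/-- The type of `test` for a head predicate of type `π` and a variable `R` of type `πR`. -/
abbrev testTy (π πR : PTy) : PTy := π.append (.arr (.pred πR) .o)

/-- The type of `add` for a variable `R` of type `πR`. -/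
abbrev addTy (πR : PTy) : PTy := .arr (.pred πR) (πR.append πR)

/-- The type of equality on `ρ`. -/
abbrev eqTy (ρ : ATy) : PTy := .arr ρ (.arr ρ .o)

/-- The new predicate constants. -/
def AuxNames.syms {N : Type} (nm : AuxNames N) (π πR : PTy) : Set (PTy × N) :=
  {(testTy π πR, nm.test), (πR, nm.empty), (addTy πR, nm.add)} ∪
    {q | ∃ ρ ∈ πR.args, q = (eqTy ρ, nm.eq)} ∪
    {q | ∃ π', ATy.pred π' ∈ πR.args ∧ q = (eqTy (.pred π'), nm.neq)}

section Transformation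

variable {C N : Type}

/-- `E X₁ ⋯ Xₙ`, a partial application. -/
def Expr.apps (π' : PTy) : {π : PTy} → Expr C N (.pred (π.append π')) → Params π →
    Expr C N (.pred π')
  | _, E, .nil => E
  | .arr ρ _, E, .cons x X => Expr.apps π' (Expr.app E (.var ρ x)) X

/-- `E X₁ ⋯ Xₙ`, an application to all arguments. -/
def Expr.appAll : {π : PTy} → Expr C N (.pred π) → Params π → Expr C N (.pred .o)
  | _, E, .nil => E
  | .arr ρ _, E, .cons x X => Expr.appAll (.app E (.var ρ x)) X

theorem nodup_pair (ρ : ATy) :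
    (Params.cons 0 (.cons 1 .nil) : Params (eqTy ρ)).vars.Nodup := by
  simp [Params.vars]

/-- The rules for `eq` and `neq` at type `ρ`:
`eq Z Y ← Z ≈ Y` if `ρ = ι`, and otherwise
`eq Z Y ← not (neq Z Y)`, `neq Z Y ← Z X₁ ⋯ Xₘ ∧ not (Y X₁ ⋯ Xₘ)` and
`neq Z Y ← not (Z X₁ ⋯ Xₘ) ∧ Y X₁ ⋯ Xₘ`. -/
def eqRules (nm : AuxNames N) : ATy → List (Rule C N)
  | .iota =>
    [⟨eqTy .iota, nm.eq, .cons 0 (.cons 1 .nil), nodup_pair _,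
      [.eq (.var .iota 0) (.var .iota 1)]⟩]
  | .pred π =>
    let Z : Expr C N (.pred π) := .var (.pred π) 0
    let Y : Expr C N (.pred π) := .var (.pred π) 1
    let X : Params π := Params.enum π 2
    [⟨eqTy (.pred π), nm.eq, .cons 0 (.cons 1 .nil), nodup_pair _,
      [.neg (.app (.app (.sym (eqTy (.pred π)) nm.neq) Z) Y)]⟩,
     ⟨eqTy (.pred π), nm.neq, .cons 0 (.cons 1 .nil), nodup_pair _,
      [.pos (Z.appAll X), .neg (Y.appAll X)]⟩,
     ⟨eqTy (.pred π), nm.neq, .cons 0 (.cons 1 .nil), nodup_pair _,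
      [.neg (Z.appAll X), .pos (Y.appAll X)]⟩]

/-- The literals `eq Z₁ Y₁, …, eq Zₙ Yₙ`. -/
def eqLits (nm : AuxNames N) : {π : PTy} → Params π → Params π → List (Lit C N)
  | _, .nil, .nil => []
  | .arr ρ _, .cons z Z, .cons y Y =>
    .pos (.app (.app (.sym (eqTy ρ) nm.eq) (.var ρ z)) (.var ρ y)) :: eqLits nm Z Y

/-- The head variables `R Z₁ ⋯ Zₙ Y₁ ⋯ Yₙ` of the rules for `add`. -/
def addParams (πR : PTy) : Params (addTy πR) :=
  .cons 0 ((Params.enum πR 1).append (Params.enum πR (1 + πR.args.length)))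

theorem nodup_addParams (πR : PTy) : (addParams πR).vars.Nodup := by
  refine List.Nodup.of_map Prod.snd ?_
  simp only [addParams, Params.vars, Params.vars_append, List.map_cons, List.map_append,
    Params.map_snd_vars_enum]
  have h : List.range' 1 πR.args.length ++ List.range' (1 + πR.args.length) πR.args.length
      = List.range' 1 (πR.args.length + πR.args.length) := by
    simp [List.range'_append_1]
  rw [h]
  have h0 : 0 :: List.range' 1 (πR.args.length + πR.args.length)
      = List.range' 0 (πR.args.length + πR.args.length + 1) := by
    simp [List.range'_succ]
  rw [h0]
  exact List.nodup_range'

/-- The rule `empty Y₁ ⋯ Yₙ ← false`, with `not (W ≈ W)` for `false`. -/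
def emptyRule (nm : AuxNames N) (πR : PTy) : Rule C N :=
  ⟨πR, nm.empty, Params.enum πR 0, Params.nodup_enum _ _, [.neq (.var .iota 0) (.var .iota 0)]⟩

/-- The rules `add R Z₁ ⋯ Zₙ Y₁ ⋯ Yₙ ← R Y₁ ⋯ Yₙ` and
`add R Z₁ ⋯ Zₙ Y₁ ⋯ Yₙ ← eq Z₁ Y₁ ∧ ⋯ ∧ eq Zₙ Yₙ`. -/
def addRules (nm : AuxNames N) (πR : PTy) : List (Rule C N) :=
  let Z : Params πR := Params.enum πR 1
  let Y : Params πR := Params.enum πR (1 + πR.args.length)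
  [⟨addTy πR, nm.add, addParams πR, nodup_addParams πR,
    [.pos (Expr.appAll (.var (.pred πR) 0) Y)]⟩,
   ⟨addTy πR, nm.add, addParams πR, nodup_addParams πR, eqLits nm Z Y⟩]

theorem nodup_testParams {π πR : PTy} {X : Params π} {R : ℕ} (hX : X.vars.Nodup)
    (hR : (ATy.pred πR, R) ∉ X.vars) :
    (X.append (.cons R .nil : Params (.arr (.pred πR) .o))).vars.Nodup := by
  rw [Params.vars_append]
  refine List.Nodup.append hX (by simp [Params.vars]) ?_
  simpa [Params.vars] using hR

/-- The rules that replace `p X₁ ⋯ Xₘ ← B`, where `R` is a variable of type `πR` other than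
`X₁, …, Xₘ`:
`p X₁ ⋯ Xₘ ← test X₁ ⋯ Xₘ empty`, `test X₁ ⋯ Xₘ R ← B`,
`test X₁ ⋯ Xₘ R ← test X₁ ⋯ Xₘ (add R Z₁ ⋯ Zₙ)`, and the rules for the auxiliary predicates.
The variables `Z₁, …, Zₙ` are distinct from each other and from `X₁, …, Xₘ, R`. -/
def newRules (nm : AuxNames N) (r : Rule C N) (πR : PTy) (R : ℕ)
    (hR : (ATy.pred πR, R) ∉ r.params.vars) : List (Rule C N) :=
  let XR : Params (testTy r.ty πR) := r.params.append (.cons R .nil)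
  let Z : Params πR := Params.enum πR XR.bound
  let testX : Expr C N (.pred (.arr (.pred πR) .o)) :=
    Expr.apps _ (.sym (testTy r.ty πR) nm.test) r.params
  [⟨r.ty, r.name, r.params, r.nodup, [.pos (.app testX (.sym πR nm.empty))]⟩,
   ⟨testTy r.ty πR, nm.test, XR, nodup_testParams r.nodup hR, r.body⟩,
   ⟨testTy r.ty πR, nm.test, XR, nodup_testParams r.nodup hR,
    [.pos (.app testX
      (Expr.apps πR (.app (.sym (addTy πR) nm.add) (.var (.pred πR) R)) Z))]⟩,
   emptyRule nm πR] ++ addRules nm πR ++ πR.args.flatMap (eqRules nm)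

open Classical in
/-- The program `P` with the rule `r` replaced by the rules `l`. -/
noncomputable def Program.replace (P : Program C N) (r : Rule C N) (l : List (Rule C N)) :
    Program C N :=
  P.erase r ∪ l.toFinset

/-- Replaces every occurrence of the variable `R` of type `o` by the atom `A`. -/
def Expr.substBool (R : ℕ) (A : Expr C N (.pred .o)) : {ρ : ATy} → Expr C N ρ → Expr C N ρ
  | .pred .o, .var _ x => if x = R then A else .var (.pred .o) x
  | _, .var ρ x => .var ρ x
  | _, .cst c => .cst c
  | _, .sym π p => .sym π p
  | _, .app E F => .app (Expr.substBool R A E) (Expr.substBool R A F)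

def Lit.substBool (R : ℕ) (A : Expr C N (.pred .o)) : Lit C N → Lit C N
  | .pos E => .pos (Expr.substBool R A E)
  | .neg E => .neg (Expr.substBool R A E)
  | .eq E F => .eq (Expr.substBool R A E) (Expr.substBool R A F)
  | .neq E F => .neq (Expr.substBool R A E) (Expr.substBool R A F)

/-- `P.TransformsTo K P'`: the program `P'` results from `P` by the transformation of one rule with
respect to a predicate variable `R` that does not occur in its head. The new predicate constants
are distinct, do not occur in `P` and do not belong to the set `K`.

The second clause is the alternative treatment of a variable `R` of type `o`: each occurrence of
`R` in the body is first replaced by `F W`, with fresh variables `F` of type `ι → o` and `W` of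
type `ι`, and then the rule is transformed with respect to `F`. -/
inductive Program.TransformsTo (K : Set (PTy × N)) (P : Program C N) : Program C N → Prop
  | direct (nm : AuxNames N) (r : Rule C N) (hr : r ∈ P) (πR : PTy) (R : ℕ)
      (hR : (ATy.pred πR, R) ∉ r.params.vars)
      (hfresh : Disjoint (nm.syms r.ty πR) (P.syms ∪ K)) :
      Program.TransformsTo K P (P.replace r (newRules nm r πR R hR))
  | bool (nm : AuxNames N) (r : Rule C N) (hr : r ∈ P) (R F W : ℕ)
      (hR : (ATy.pred .o, R) ∉ r.params.vars)
      (hF : (ATy.pred (.arr .iota .o), F) ∉ r.vars)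
      (hW : (ATy.iota, W) ∉ r.vars)
      (hfresh : Disjoint (nm.syms r.ty (.arr .iota .o)) (P.syms ∪ K)) :
      Program.TransformsTo K P (P.replace r (newRules nm
        { r with
          body := r.body.map (Lit.substBool R
            (.app (.var (.pred (.arr .iota .o)) F) (.var .iota W))) }
        (.arr .iota .o) F (fun h => hF (Or.inl h))))

end Transformation

end HODatalog

namespace HODatalog

/-! ## Finiteness of the semantic domains -/

-- Consider a stable fixpoint of the transformed program over a finite nonempty universe. The
-- auxiliary predicates other than `test` are two-valued there and mean what they should: `empty` is
-- `⊥`, `neq` is computed from variables alone, `eq` from `neq`, and `add` from `eq`. The arguments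
-- passed to `test` are therefore exact pairs `(v, v)`, and application to an exact pair is ordinary
-- application (`Expr.eval_app_of_exact`): the meets and joins of the pair semantics lose nothing.
--
-- What remains is a recursion for `test`: it holds at `d, v` if the body holds with `R = v`, or if
-- `test` holds at `d, v ∪ {z}` for some tuple `z`. Its least solution is `Rule.bodyEx`, "the body
-- holds for some `R ≥ v`". It is a solution by `Rule.testHolds_bodyEx_iff`, and the least one
-- because over a finite universe every `v' ≥ v` arises from `v` by finitely many additions
-- (`of_le_of_adjoin`). At `v = ⊥` the restriction on `R` is void, so the new rule for `p` derives
-- exactly what the old one derived.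
--
-- Hence the stable fixpoints of the two programs correspond: `(I, J)` goes to the pair that extends
-- `I` and `J` by the intended values, with `test` interpreted by the two components of `bodyEx`
-- (`IsTransformed.isStableFixpoint_extend`, `IsTransformed.exists_eq_extend`). To transfer
-- minimality, stability is first restated with prefixpoints (`isStableFixpoint_iff`): the only
-- competitors are prefixpoints below `I`, respectively between `I` and `J`, and in those the
-- auxiliary predicates are still exact. The correspondence preserves and reflects precision,
-- respects `I = J`, and leaves the predicates of the schemas alone, so all three readings agree.
--
-- The new rules contain the same constants as the old one, so the Herbrand universe does not
-- change. Over an empty universe there are no states and neither program derives anything. The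
-- variant for type `o` reduces to the main case, since `F W` can take any truth value when `F` is
-- fresh (`Rule.fires_guard`).

mutual

theorem PTy.finite_sem (U : Type) [Finite U] : (π : PTy) → Finite (PTy.sem U π)
  | .o => inferInstanceAs (Finite Prop)
  | .arr ρ π =>
    have := ATy.finite_sem U ρ
    have := PTy.finite_sem U π
    inferInstanceAs (Finite (ATy.sem U ρ → PTy.sem U π))

theorem ATy.finite_sem (U : Type) [Finite U] : (ρ : ATy) → Finite (ATy.sem U ρ)
  | .iota => inferInstanceAs (Finite U)
  | .pred π => PTy.finite_sem U π

end

theorem PTy.finite_tuple (U : Type) [Finite U] : (π : PTy) → Finite (PTy.Tuple U π)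
  | .o => inferInstanceAs (Finite Unit)
  | .arr ρ π =>
    have := ATy.finite_sem U ρ
    have := PTy.finite_tuple U π
    inferInstanceAs (Finite (ATy.sem U ρ × PTy.Tuple U π))

/-! ## Application to tuples -/

section Tuples

variable {U : Type}

/-- The truth value of `f d₁ ⋯ dₙ`. -/
def PTy.holds : {π : PTy} → PTy.sem U π → PTy.Tuple U π → Prop
  | .o, f, _ => f
  | .arr _ _, f, d => PTy.holds (f d.1) d.2

/-- The partial application `f d₁ ⋯ dₘ`. -/
def PTy.applyT : {π π' : PTy} → PTy.sem U (π.append π') → PTy.Tuple U π → PTy.sem U π'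
  | .o, _, f, _ => f
  | .arr _ _, _, f, d => PTy.applyT (f d.1) d.2

/-- Abstraction over a tuple, the inverse of `PTy.applyT`. -/
def PTy.lam : {π π' : PTy} → (PTy.Tuple U π → PTy.sem U π') → PTy.sem U (π.append π')
  | .o, _, f => f ()
  | .arr _ _, _, f => fun a => PTy.lam fun d => f (a, d)

/-- Concatenation of tuples. -/
def PTy.Tuple.append : {π π' : PTy} → PTy.Tuple U π → PTy.Tuple U π' → PTy.Tuple U (π.append π')
  | .o, _, _, e => e
  | .arr _ _, _, d, e => (d.1, PTy.Tuple.append d.2 e)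

theorem PTy.holds_ofSet : ∀ {π : PTy} (S : PTy.Tuple U π → Prop) (d : PTy.Tuple U π),
    PTy.holds (PTy.ofSet π S) d ↔ S d
  | .o, _, _ => Iff.rfl
  | .arr _ _, S, d => PTy.holds_ofSet (fun e => S (d.1, e)) d.2

/-- Curried functions into `Prop` are handled throughout as relations on tuples; the pointwise order
is then inclusion. -/
theorem PTy.le_iff : ∀ {π : PTy} {f g : PTy.sem U π},
    f ≤ g ↔ ∀ d, PTy.holds f d → PTy.holds g d
  | .o, _, _ => ⟨fun h _ => h, fun h => h ()⟩
  | .arr _ _, _, _ =>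
    ⟨fun h d => PTy.le_iff.1 (h d.1) d.2, fun h a => PTy.le_iff.2 fun e => h (a, e)⟩

theorem PTy.sem_ext {π : PTy} {f g : PTy.sem U π}
    (h : ∀ d, PTy.holds f d ↔ PTy.holds g d) : f = g :=
  le_antisymm (PTy.le_iff.2 fun d => (h d).1) (PTy.le_iff.2 fun d => (h d).2)

theorem PTy.holds_bot {π : PTy} (d : PTy.Tuple U π) :
    ¬ PTy.holds (⊥ : PTy.sem U π) d := fun h =>
  (PTy.holds_ofSet (fun _ => False) d).1 (PTy.le_iff.1 bot_le d h)

theorem PTy.applyT_lam : ∀ {π π' : PTy} (f : PTy.Tuple U π → PTy.sem U π') (d : PTy.Tuple U π),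
    PTy.applyT (PTy.lam f) d = f d
  | .o, _, _, _ => rfl
  | .arr _ _, _, f, d => PTy.applyT_lam (fun e => f (d.1, e)) d.2

theorem PTy.holds_append : ∀ {π π' : PTy} (f : PTy.sem U (π.append π')) (d : PTy.Tuple U π)
    (e : PTy.Tuple U π'), PTy.holds f (d.append e) ↔ PTy.holds (PTy.applyT f d) e
  | .o, _, _, _, _ => Iff.rfl
  | .arr _ _, _, f, d, e => PTy.holds_append (f d.1) d.2 e

theorem PTy.Tuple.exists_append : ∀ {π π' : PTy} (d : PTy.Tuple U (π.append π')),
    ∃ (d₁ : PTy.Tuple U π) (d₂ : PTy.Tuple U π'), d = d₁.append d₂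
  | .o, _, d => ⟨(), d, rfl⟩
  | .arr _ _, _, (a, d) =>
    let ⟨d₁, d₂, h⟩ := PTy.Tuple.exists_append d
    ⟨(a, d₁), d₂, congrArg (Prod.mk a) h⟩

theorem PTy.Tuple.append_inj : ∀ {π π' : PTy} {d d' : PTy.Tuple U π} {e e' : PTy.Tuple U π'},
    d.append e = d'.append e' ↔ d = d' ∧ e = e'
  | .o, _, _, _, _, _ => ⟨fun h => ⟨rfl, h⟩, fun h => h.2⟩
  | .arr _ _, _, (a, d), (a', d'), e, e' => by
    have ih := PTy.Tuple.append_inj (d := d) (d' := d') (e := e) (e' := e')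
    constructor
    · intro h
      obtain ⟨h₁, h₂⟩ := Prod.mk.inj h
      obtain ⟨h₃, h₄⟩ := ih.1 h₂
      exact ⟨Prod.ext h₁ h₃, h₄⟩
    · rintro ⟨h, rfl⟩
      cases h
      rfl

theorem PTy.le_iff_applyT {π π' : PTy} {f g : PTy.sem U (π.append π')} :
    f ≤ g ↔ ∀ d, PTy.applyT f d ≤ PTy.applyT g d := by
  rw [PTy.le_iff]
  constructor
  · intro h d
    refine PTy.le_iff.2 fun e he => ?_
    rw [← PTy.holds_append] at he ⊢
    exact h _ he
  · intro h d hd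
    obtain ⟨d₁, d₂, rfl⟩ := PTy.Tuple.exists_append d
    rw [PTy.holds_append] at hd ⊢
    exact PTy.le_iff.1 (h d₁) d₂ hd

theorem Params.eval_append (s : State U) : ∀ {π π' : PTy} (X : Params π) (Y : Params π'),
    (X.append Y).eval s = (X.eval s).append (Y.eval s)
  | _, _, .nil, _ => rfl
  | _, _, .cons x X, Y => congrArg (Prod.mk (s _ x)) (Params.eval_append s X Y)

end Tuples

/-! ## States -/

section States

variable {U : Type}

open Classical in
/-- The state `s[R/v]`. -/
noncomputable def State.set (s : State U) (ρ : ATy) (x : ℕ) (v : ATy.sem U ρ) : State U :=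
  Function.update s ρ (Function.update (s ρ) x v)

theorem State.set_self (s : State U) (ρ : ATy) (x : ℕ) (v : ATy.sem U ρ) :
    s.set ρ x v ρ x = v := by
  simp [State.set]

theorem State.set_of_ne (s : State U) {ρ ρ' : ATy} {x y : ℕ} (v : ATy.sem U ρ)
    (h : (ρ', y) ≠ (ρ, x)) : s.set ρ x v ρ' y = s ρ' y := by
  by_cases hρ : ρ' = ρ
  · subst hρ
    have : y ≠ x := fun hy => h (by rw [hy])
    simp [State.set, this]
  · simp [State.set, hρ]

theorem Params.eval_congr {s s' : State U} : ∀ {π : PTy} (X : Params π),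
    (∀ v ∈ X.vars, s v.1 v.2 = s' v.1 v.2) → X.eval s = X.eval s'
  | _, .nil, _ => rfl
  | _, .cons x X, h => Prod.ext (h (_, x) (List.mem_cons_self ..))
      (Params.eval_congr X fun v hv => h v (List.mem_cons_of_mem _ hv))

/-- Since the variables are distinct, assigning the first one does not disturb the others. The state
`s` only provides a starting point, as states need not exist. -/
theorem Params.exists_eval_eq (s : State U) : ∀ {π : PTy} (X : Params π), X.vars.Nodup →
    ∀ d : PTy.Tuple U π, ∃ s' : State U, X.eval s' = d
  | _, .nil, _, _ => ⟨s, rfl⟩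
  | .arr ρ _, .cons x X, h, (a, d) => by
    obtain ⟨h₁, h₂⟩ := List.nodup_cons.1 h
    obtain ⟨s', hs'⟩ := Params.exists_eval_eq s X h₂ d
    refine ⟨s'.set ρ x a, Prod.ext (State.set_self ..) ?_⟩
    refine (Params.eval_congr X fun v hv => ?_).trans hs'
    exact State.set_of_ne _ _ fun hv' => h₁ (hv' ▸ hv)

theorem State.nonempty (U : Type) [Nonempty U] : Nonempty (State U) :=
  ⟨fun ρ _ => match ρ with
    | .iota => Classical.arbitrary U
    | .pred π => (⊥ : PTy.sem U π)⟩

/-- A state has to give a value to individual variables, so over an empty universe no rule can ever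
fire. -/
theorem State.isEmpty (U : Type) [IsEmpty U] : IsEmpty (State U) :=
  ⟨fun s => IsEmpty.false (α := U) (s .iota 0)⟩

theorem Params.lt_bound : ∀ {π : PTy} (X : Params π), ∀ v ∈ X.vars, v.2 < X.bound
  | _, .nil, _, h => by simp [Params.vars] at h
  | _, .cons x X, v, h => by
    rcases List.mem_cons.1 h with rfl | h
    · exact lt_max_of_lt_left (Nat.lt_succ_self x)
    · exact lt_max_of_lt_right (X.lt_bound v h)

theorem Params.le_of_mem_enum {π : PTy} {k : ℕ} {v : ATy × ℕ}
    (hv : v ∈ (Params.enum π k).vars) : k ≤ v.2 := by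
  have h := List.mem_map_of_mem (f := Prod.snd) hv
  rw [Params.map_snd_vars_enum] at h
  exact (List.mem_range'_1.1 h).1

/-- Numbers from `X.bound` on are fresh for `X`. This makes the variables `Z̄` of the recursive rule
for `test` independent of its head variables. -/
theorem Params.nodup_append_enum {π π' : PTy} {X : Params π} (hX : X.vars.Nodup) {k : ℕ}
    (hk : X.bound ≤ k) : (X.append (Params.enum π' k)).vars.Nodup := by
  rw [Params.vars_append]
  refine List.Nodup.append hX (Params.nodup_enum _ _) fun v hv hv' => ?_
  have := X.lt_bound v hv
  have := Params.le_of_mem_enum hv'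
  omega

end States

/-! ## Components of pairs -/

/-- The first component for `false`, the second for `true`. -/
def sel {α : Type*} : Bool → α × α → α
  | false, x => x.1
  | true, x => x.2

/-! ## Evaluation -/

section Evaluation

variable {C N : Type} {U : Set C}

/-- The interval from `v` to `v` is a singleton, so the meet and the join each have one term. -/
theorem Expr.eval_app_of_exact (I J : Interp U N) (s : State U) {ρ : ATy} {π : PTy}
    (E : Expr C N (.pred (.arr ρ π))) {F : Expr C N ρ} {v : ATy.sem U ρ}
    (h : F.eval I J s = (v, v)) :
    (Expr.app E F).eval I J s =
      (((E.eval I J s).1 : ATy.sem U ρ → PTy.sem U π) v,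
        ((E.eval I J s).2 : ATy.sem U ρ → PTy.sem U π) v) := by
  rw [Expr.eval]
  simp only [h, Set.Icc_self, Set.mem_singleton_iff, iInf_iInf_eq_left, iSup_iSup_eq_left]
  rfl

/-- A more precise argument shrinks the interval, which raises the meet and lowers the join.
Consistency has to be proved in the same induction: it makes the interval of the argument nonempty,
and only then is the meet below the join. -/
theorem Expr.eval_mono {I I' J J' : Interp U N} (hI : I ≤ I') (hIJ : I' ≤ J') (hJ : J' ≤ J)
    (s : State U) : ∀ {ρ : ATy} (E : Expr C N ρ),
      (E.eval I J s).1 ≤ (E.eval I' J' s).1 ∧ (E.eval I' J' s).1 ≤ (E.eval I' J' s).2 ∧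
        (E.eval I' J' s).2 ≤ (E.eval I J s).2
  | _, .var _ _ => ⟨le_rfl, le_rfl, le_rfl⟩
  | _, .cst _ => ⟨le_rfl, le_rfl, le_rfl⟩
  | _, .sym π p => ⟨hI π p, hIJ π p, hJ π p⟩
  | _, @Expr.app _ _ ρ π E F => by
    obtain ⟨e₁, e₂, e₃⟩ := Expr.eval_mono hI hIJ hJ s E
    obtain ⟨f₁, f₂, f₃⟩ := Expr.eval_mono hI hIJ hJ s F
    have hsub : Set.Icc (F.eval I' J' s).1 (F.eval I' J' s).2 ⊆
        Set.Icc (F.eval I J s).1 (F.eval I J s).2 := Set.Icc_subset_Icc f₁ f₃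
    have hmem : (F.eval I' J' s).1 ∈ Set.Icc (F.eval I' J' s).1 (F.eval I' J' s).2 :=
      ⟨le_rfl, f₂⟩
    refine ⟨?_, ?_, ?_⟩
    · exact le_iInf₂ (α := PTy.sem U π) fun d hd =>
        (iInf₂_le (α := PTy.sem U π) d (hsub hd)).trans (e₁ d)
    · exact (iInf₂_le (α := PTy.sem U π) _ hmem).trans ((e₂ _).trans
        (le_iSup₂ (α := PTy.sem U π) (f := fun d _ =>
          ((E.eval I' J' s).2 : ATy.sem U ρ → PTy.sem U π) d) _ hmem))
    · exact iSup₂_le (α := PTy.sem U π) fun d hd => (e₃ d).trans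
        (le_iSup₂ (α := PTy.sem U π) (f := fun d _ =>
          ((E.eval I J s).2 : ATy.sem U ρ → PTy.sem U π) d) d (hsub hd))

theorem Expr.eval_self (I : Interp U N) (s : State U) : ∀ {ρ : ATy} (E : Expr C N ρ),
    E.eval I I s = ((E.eval I I s).1, (E.eval I I s).1)
  | _, .var _ _ => rfl
  | _, .cst _ => rfl
  | _, .sym _ _ => rfl
  | _, .app E F => by
    have hE := Expr.eval_self I s E
    rw [Expr.eval_app_of_exact I I s E (Expr.eval_self I s F), hE]
    rfl

theorem Expr.eval_congr {I I' J J' : Interp U N} (s : State U) : ∀ {ρ : ATy} (E : Expr C N ρ),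
    (∀ q ∈ E.syms, I q.1 q.2 = I' q.1 q.2 ∧ J q.1 q.2 = J' q.1 q.2) →
      E.eval I J s = E.eval I' J' s
  | _, .var _ _, _ => rfl
  | _, .cst _, _ => rfl
  | _, .sym π p, h => Prod.ext (h (π, p) rfl).1 (h (π, p) rfl).2
  | _, .app E F, h => by
    rw [Expr.eval, Expr.eval, Expr.eval_congr s E fun q hq => h q (Or.inl hq),
      Expr.eval_congr s F fun q hq => h q (Or.inr hq)]

/-- The hypothesis `h0` is needed because a constant outside `U` gets the default value `s .iota 0`.
-/
theorem Expr.eval_congr_state {I J : Interp U N} {s s' : State U}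
    (h0 : s .iota 0 = s' .iota 0) : ∀ {ρ : ATy} (E : Expr C N ρ),
    (∀ v ∈ E.vars, s v.1 v.2 = s' v.1 v.2) → E.eval I J s = E.eval I J s'
  | _, .var ρ x, h => Prod.ext (h (ρ, x) rfl) (h (ρ, x) rfl)
  | _, .cst _, _ => by simp only [Expr.eval, h0]
  | _, .sym _ _, _ => rfl
  | _, .app E F, h => by
    rw [Expr.eval, Expr.eval, Expr.eval_congr_state h0 E fun q hq => h q (Or.inl hq),
      Expr.eval_congr_state h0 F fun q hq => h q (Or.inr hq)]

theorem Expr.eval_apps (I J : Interp U N) (s : State U) (π' : PTy) : ∀ {π : PTy}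
    (E : Expr C N (.pred (π.append π'))) (X : Params π),
    (Expr.apps π' E X).eval I J s =
      (PTy.applyT (π := π) (π' := π') (E.eval I J s).1 (X.eval s),
        PTy.applyT (π := π) (π' := π') (E.eval I J s).2 (X.eval s))
  | _, _, .nil => rfl
  | .arr ρ π, E, .cons x X => by
    rw [Expr.apps, Expr.eval_apps I J s π' (Expr.app E (.var ρ x)) X,
      Expr.eval_app_of_exact I J s (ρ := ρ) (π := π.append π') E (v := s ρ x) rfl]
    rfl

theorem Expr.eval_appAll (I J : Interp U N) (s : State U) : ∀ {π : PTy}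
    (E : Expr C N (.pred π)) (X : Params π),
    (E.appAll X).eval I J s =
      (PTy.holds (π := π) (E.eval I J s).1 (X.eval s),
        PTy.holds (π := π) (E.eval I J s).2 (X.eval s))
  | _, _, .nil => rfl
  | .arr ρ π, E, .cons x X => by
    rw [Expr.appAll, Expr.eval_appAll I J s (Expr.app E (.var ρ x)) X,
      Expr.eval_app_of_exact I J s E (v := s ρ x) rfl]
    rfl

theorem Lit.eval_mono {I I' J J' : Interp U N} (hI : I ≤ I') (hIJ : I' ≤ J') (hJ : J' ≤ J)
    (s : State U) : ∀ L : Lit C N,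
      ((L.eval I J s).1 → (L.eval I' J' s).1) ∧ ((L.eval I' J' s).1 → (L.eval I' J' s).2) ∧
        ((L.eval I' J' s).2 → (L.eval I J s).2)
  | .pos E => Expr.eval_mono hI hIJ hJ s E
  | .neg E =>
    let ⟨h₁, h₂, h₃⟩ := Expr.eval_mono hI hIJ hJ s E
    ⟨fun h h' => h (h₃ h'), fun h h' => h (h₂ h'), fun h h' => h (h₁ h')⟩
  | .eq E F => by
    -- An expression of type `ι` is a variable or a constant, as applications have predicate types;
    -- its value does not depend on the interpretations.
    have key : ∀ E : Expr C N .iota, E.eval I J s = E.eval I' J' s := fun E => by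
      cases E <;> rfl
    simp only [Lit.eval, key]; tauto
  | .neq E F => by
    have key : ∀ E : Expr C N .iota, E.eval I J s = E.eval I' J' s := fun E => by
      cases E <;> rfl
    simp only [Lit.eval, key]; tauto

theorem Lit.eval_self (I : Interp U N) (s : State U) (L : Lit C N) :
    (L.eval I I s).1 = (L.eval I I s).2 := by
  cases L with
  | pos E => exact (congrArg Prod.snd (Expr.eval_self I s E)).symm
  | neg E => exact congrArg Not (congrArg Prod.snd (Expr.eval_self I s E))
  | eq E F => rfl
  | neq E F => rfl

theorem Lit.eval_congr {I I' J J' : Interp U N} (s : State U) (L : Lit C N)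
    (h : ∀ q ∈ L.syms, I q.1 q.2 = I' q.1 q.2 ∧ J q.1 q.2 = J' q.1 q.2) :
    L.eval I J s = L.eval I' J' s := by
  cases L with
  | pos E => rw [Lit.eval, Lit.eval, E.eval_congr s h]
  | neg E => rw [Lit.eval, Lit.eval, E.eval_congr s h]
  | eq E F => rw [Lit.eval, Lit.eval, E.eval_congr s fun q hq => h q (Or.inl hq),
      F.eval_congr s fun q hq => h q (Or.inr hq)]
  | neq E F => rw [Lit.eval, Lit.eval, E.eval_congr s fun q hq => h q (Or.inl hq),
      F.eval_congr s fun q hq => h q (Or.inr hq)]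

theorem Lit.eval_congr_state {I J : Interp U N} {s s' : State U}
    (h0 : s .iota 0 = s' .iota 0) (L : Lit C N)
    (h : ∀ v ∈ L.vars, s v.1 v.2 = s' v.1 v.2) : L.eval I J s = L.eval I J s' := by
  cases L with
  | pos E => rw [Lit.eval, Lit.eval, E.eval_congr_state h0 h]
  | neg E => rw [Lit.eval, Lit.eval, E.eval_congr_state h0 h]
  | eq E F => rw [Lit.eval, Lit.eval, E.eval_congr_state h0 fun q hq => h q (Or.inl hq),
      F.eval_congr_state h0 fun q hq => h q (Or.inr hq)]
  | neq E F => rw [Lit.eval, Lit.eval, E.eval_congr_state h0 fun q hq => h q (Or.inl hq),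
      F.eval_congr_state h0 fun q hq => h q (Or.inr hq)]

theorem sel_bodyEval (b : Bool) (I J : Interp U N) (s : State U) (B : List (Lit C N)) :
    sel b (bodyEval I J s B) ↔ ∀ L ∈ B, sel b (L.eval I J s) := by
  cases b <;> rfl

theorem bodyEval_congr {I I' J J' : Interp U N} (s : State U) {B : List (Lit C N)}
    (h : ∀ L ∈ B, ∀ q ∈ L.syms, I q.1 q.2 = I' q.1 q.2 ∧ J q.1 q.2 = J' q.1 q.2) :
    bodyEval I J s B = bodyEval I' J' s B := by
  simp only [bodyEval]
  congr 1
  · exact propext (forall₂_congr fun L hL => by rw [L.eval_congr s (h L hL)])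
  · exact propext (forall₂_congr fun L hL => by rw [L.eval_congr s (h L hL)])

theorem bodyEval_mono {I I' J J' : Interp U N} (hI : I ≤ I') (hIJ : I' ≤ J') (hJ : J' ≤ J)
    (s : State U) (B : List (Lit C N)) :
    ((bodyEval I J s B).1 → (bodyEval I' J' s B).1) ∧
      ((bodyEval I' J' s B).1 → (bodyEval I' J' s B).2) ∧
      ((bodyEval I' J' s B).2 → (bodyEval I J s B).2) :=
  ⟨fun h L hL => (L.eval_mono hI hIJ hJ s).1 (h L hL),
    fun h L hL => (L.eval_mono hI hIJ hJ s).2.1 (h L hL),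
    fun h L hL => (L.eval_mono hI hIJ hJ s).2.2 (h L hL)⟩

theorem bodyEval_self (b : Bool) (I : Interp U N) (s : State U) (B : List (Lit C N)) :
    sel b (bodyEval I I s B) ↔ (bodyEval I I s B).1 := by
  cases b
  · exact Iff.rfl
  · exact forall₂_congr fun L _ => by rw [L.eval_self]

/-! ## The approximating operator -/

/-- The rule `r` derives `p d`, in component `b`, from `(I, J)`. -/
def Rule.Fires (b : Bool) (I J : Interp U N) (r : Rule C N) (π : PTy) (p : N)
    (d : PTy.Tuple U π) : Prop :=
  ∃ X h B, r = ⟨π, p, X, h, B⟩ ∧ ∃ s : State U, X.eval s = d ∧ sel b (bodyEval I J s B)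

theorem Rule.fires_mk (b : Bool) (I J : Interp U N) {π : PTy} {p : N} (X : Params π)
    (h : X.vars.Nodup) (B : List (Lit C N)) (d : PTy.Tuple U π) :
    (⟨π, p, X, h, B⟩ : Rule C N).Fires b I J π p d ↔
      ∃ s : State U, X.eval s = d ∧ sel b (bodyEval I J s B) := by
  constructor
  · rintro ⟨X', h', B', e, s, hs⟩
    cases e
    exact ⟨s, hs⟩
  · rintro ⟨s, hs⟩
    exact ⟨X, h, B, rfl, s, hs⟩

theorem Rule.Fires.head_eq {b : Bool} {I J : Interp U N} {r : Rule C N} {π : PTy} {p : N}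
    {d : PTy.Tuple U π} (h : r.Fires b I J π p d) : (π, p) = (r.ty, r.name) := by
  obtain ⟨X, h, B, rfl, _⟩ := h
  rfl

theorem Rule.fires_congr {b : Bool} {I I' J J' : Interp U N} {r : Rule C N}
    (h : ∀ q ∈ r.syms, I q.1 q.2 = I' q.1 q.2 ∧ J q.1 q.2 = J' q.1 q.2) {π : PTy} {p : N}
    {d : PTy.Tuple U π} : r.Fires b I J π p d ↔ r.Fires b I' J' π p d := by
  unfold Rule.Fires
  refine exists₃_congr fun X hX B => and_congr_right fun e => exists_congr fun s => ?_
  subst e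
  rw [bodyEval_congr s fun L hL q hq => h q (Or.inr ⟨L, hL, hq⟩)]

theorem Program.holds_approx (P : Program C N) (b : Bool) (I J : Interp U N) (π : PTy) (p : N)
    (d : PTy.Tuple U π) :
    PTy.holds (sel b (P.approx U I J) π p) d ↔ ∃ r ∈ P, r.Fires b I J π p d := by
  have key : PTy.holds (sel b (P.approx U I J) π p) d ↔
      ∃ X h B, (⟨π, p, X, h, B⟩ : Rule C N) ∈ P ∧
        ∃ s : State U, X.eval s = d ∧ sel b (bodyEval I J s B) := by
    cases b <;> exact PTy.holds_ofSet _ d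
  rw [key]
  constructor
  · rintro ⟨X, h, B, hP, hs⟩
    exact ⟨_, hP, X, h, B, rfl, hs⟩
  · rintro ⟨r, hP, X, h, B, rfl, hs⟩
    exact ⟨X, h, B, hP, hs⟩

theorem Program.approx_mono (P : Program C N) {I I' J J' : Interp U N} (hI : I ≤ I')
    (hIJ : I' ≤ J') (hJ : J' ≤ J) :
    (P.approx U I J).1 ≤ (P.approx U I' J').1 ∧ (P.approx U I' J').1 ≤ (P.approx U I' J').2 ∧
      (P.approx U I' J').2 ≤ (P.approx U I J).2 := by
  refine ⟨fun π p => PTy.le_iff.2 fun d hd => ?_, fun π p => PTy.le_iff.2 fun d hd => ?_,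
    fun π p => PTy.le_iff.2 fun d hd => ?_⟩
  all_goals
    obtain ⟨X, h, B, hP, s, hs, hB⟩ := (PTy.holds_ofSet _ d).1 hd
    obtain ⟨h₁, h₂, h₃⟩ := bodyEval_mono hI hIJ hJ s B
    refine (PTy.holds_ofSet _ d).2 ⟨X, h, B, hP, s, hs, ?_⟩
  exacts [h₁ hB, h₂ hB, h₃ hB]

end Evaluation

/-! ## The intended meaning of the auxiliary predicates -/

section Canonical

variable {N U : Type}

open Classical in
/-- The interpretation `I` with the value of one predicate constant changed to `v`. -/
noncomputable def Interp.set (I : Interp U N) (π : PTy) (p : N) (v : PTy.sem U π) :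
    Interp U N :=
  Function.update I π (Function.update (I π) p v)

theorem Interp.set_self (I : Interp U N) (π : PTy) (p : N) (v : PTy.sem U π) :
    I.set π p v π p = v := by
  simp [Interp.set]

theorem Interp.set_of_ne (I : Interp U N) {π π' : PTy} {p p' : N} (v : PTy.sem U π)
    (h : (π', p') ≠ (π, p)) : I.set π p v π' p' = I π' p' := by
  by_cases hπ : π' = π
  · subst hπ
    have : p' ≠ p := fun hp => h (by rw [hp])
    simp [Interp.set, this]
  · simp [Interp.set, hπ]

/-- Equality, for predicate types `ρ → ρ → o`. -/
noncomputable def PTy.eqVal : (π : PTy) → PTy.sem U π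
  -- The pattern does not force the two argument types to coincide, hence heterogeneous equality; at
  -- `eqTy ρ` it is ordinary equality.
  | .arr _ (.arr _ .o) => fun a b => HEq a b
  | _ => ⊥

/-- Inequality, for predicate types `ρ → ρ → o`. -/
noncomputable def PTy.neqVal : (π : PTy) → PTy.sem U π
  | .arr _ (.arr _ .o) => fun a b => ¬ HEq a b
  | _ => ⊥

/-- The pair `(a, c)`, as a tuple. -/
def PTy.Tuple.pair {ρ : ATy} (a c : ATy.sem U ρ) : PTy.Tuple U (eqTy ρ) := (a, c, ())

theorem PTy.Tuple.pair_inj {ρ : ATy} {a c a' c' : ATy.sem U ρ} :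
    Tuple.pair a c = Tuple.pair a' c' ↔ a = a' ∧ c = c' :=
  ⟨fun h => ⟨congrArg Prod.fst h, congrArg (fun x => x.2.1) h⟩, fun h => by rw [h.1, h.2]⟩

/-- The tuple `(v, z₁, …, zₙ, y₁, …, yₙ)`. -/
def PTy.Tuple.addArgs {πR : PTy} (v : PTy.sem U πR) (z y : PTy.Tuple U πR) :
    PTy.Tuple U (addTy πR) := (v, z.append y)

/-- The tuple `(d₁, …, dₘ, v)`. -/
def PTy.Tuple.snoc {π πR : PTy} (d : PTy.Tuple U π) (v : PTy.sem U πR) :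
    PTy.Tuple U (testTy π πR) := d.append (π' := .arr (.pred πR) .o) (v, ())

theorem PTy.holds_eqVal {ρ : ATy} (a b : ATy.sem U ρ) :
    PTy.holds (PTy.eqVal (eqTy ρ)) (Tuple.pair a b) ↔ a = b := heq_iff_eq

theorem PTy.holds_neqVal {ρ : ATy} (a b : ATy.sem U ρ) :
    PTy.holds (PTy.neqVal (eqTy ρ)) (Tuple.pair a b) ↔ a ≠ b := not_congr heq_iff_eq

/-- The relation `v` together with the tuple `z`. -/
def PTy.adjoin {π : PTy} (v : PTy.sem U π) (z : PTy.Tuple U π) : PTy.sem U π :=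
  PTy.ofSet π fun y => PTy.holds v y ∨ z = y

theorem PTy.holds_adjoin {π : PTy} (v : PTy.sem U π) (z y : PTy.Tuple U π) :
    PTy.holds (PTy.adjoin v z) y ↔ PTy.holds v y ∨ z = y :=
  PTy.holds_ofSet _ _

theorem PTy.le_adjoin {π : PTy} (v : PTy.sem U π) (z : PTy.Tuple U π) : v ≤ PTy.adjoin v z :=
  PTy.le_iff.2 fun y hy => (PTy.holds_adjoin v z y).2 (Or.inl hy)

/-- The function `v z₁ ⋯ zₙ ↦ v ∪ {(z₁, …, zₙ)}`. -/
def PTy.addVal (π : PTy) : PTy.sem U (addTy π) :=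
  (fun v => PTy.lam (PTy.adjoin v) : PTy.sem U π → PTy.sem U (π.append π))

open Classical in
/-- The intended meaning of the auxiliary predicates other than `test`. -/
noncomputable def AuxNames.canon (nm : AuxNames N) (πR : PTy) : Interp U N :=
  Interp.set (fun π p => if p = nm.eq then π.eqVal else if p = nm.neq then π.neqVal else ⊥)
    (addTy πR) nm.add πR.addVal

variable (nm : AuxNames N)

theorem AuxNames.ne : nm.test ≠ nm.empty ∧ nm.test ≠ nm.add ∧ nm.test ≠ nm.eq ∧
    nm.test ≠ nm.neq ∧ nm.empty ≠ nm.add ∧ nm.empty ≠ nm.eq ∧ nm.empty ≠ nm.neq ∧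
    nm.add ≠ nm.eq ∧ nm.add ≠ nm.neq ∧ nm.eq ≠ nm.neq := by
  have := nm.nodup
  simp only [List.nodup_cons, List.mem_cons, List.not_mem_nil, or_false, not_or] at this
  tauto

theorem AuxNames.canon_add (πR : PTy) :
    (nm.canon πR : Interp U N) (addTy πR) nm.add = πR.addVal :=
  Interp.set_self ..

theorem AuxNames.canon_empty (πR : PTy) : (nm.canon πR : Interp U N) πR nm.empty = ⊥ := by
  obtain ⟨-, -, -, -, h₁, h₂, h₃, -⟩ := nm.ne
  rw [AuxNames.canon, Interp.set_of_ne _ _ fun h => h₁ (Prod.mk.inj h).2, if_neg h₂, if_neg h₃]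

theorem AuxNames.canon_eq (πR π : PTy) :
    (nm.canon πR : Interp U N) π nm.eq = π.eqVal := by
  obtain ⟨-, -, -, -, -, -, -, h₁, -⟩ := nm.ne
  rw [AuxNames.canon, Interp.set_of_ne _ _ fun h => h₁ (Prod.mk.inj h).2.symm, if_pos rfl]

theorem AuxNames.canon_neq (πR π : PTy) :
    (nm.canon πR : Interp U N) π nm.neq = π.neqVal := by
  obtain ⟨-, -, -, -, -, -, -, -, h₁, h₂⟩ := nm.ne
  rw [AuxNames.canon, Interp.set_of_ne _ _ fun h => h₁ (Prod.mk.inj h).2.symm, if_neg h₂.symm,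
    if_pos rfl]

/-- The truth value of `T d v`. -/
def testHolds {π πR : PTy} (T : PTy.sem U (testTy π πR)) (d : PTy.Tuple U π)
    (v : PTy.sem U πR) : Prop :=
  (PTy.applyT T d : PTy.sem U πR → Prop) v

/-- The element of the meaning of the type of `test` that is given by a relation. -/
def testMk {π πR : PTy} (S : PTy.Tuple U π → PTy.sem U πR → Prop) : PTy.sem U (testTy π πR) :=
  PTy.lam fun d => (S d : PTy.sem U πR → Prop)

theorem testHolds_mk {π πR : PTy} (S : PTy.Tuple U π → PTy.sem U πR → Prop)
    (d : PTy.Tuple U π) (v : PTy.sem U πR) : testHolds (testMk S) d v ↔ S d v := by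
  exact iff_of_eq (congrFun (PTy.applyT_lam (π' := .arr (.pred πR) .o) S d) v)

theorem holds_snoc {π πR : PTy} (T : PTy.sem U (testTy π πR)) (d : PTy.Tuple U π)
    (v : PTy.sem U πR) : PTy.holds T (d.snoc v) ↔ testHolds T d v :=
  PTy.holds_append (π' := .arr (.pred πR) .o) T d (v, ())

theorem testTy_le_iff {π πR : PTy} {T T' : PTy.sem U (testTy π πR)} :
    T ≤ T' ↔ ∀ d v, testHolds T d v → testHolds T' d v :=
  PTy.le_iff_applyT

/-- The interpretation with the intended meaning for the auxiliary predicates, the value `T` for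
`test`, and the values of `I` elsewhere. -/
noncomputable def AuxNames.extend (π πR : PTy) (I : Interp U N) (T : PTy.sem U (testTy π πR)) :
    Interp U N :=
  open Classical in
  Interp.set (fun π' p => if (π', p) ∈ nm.syms π πR then nm.canon πR π' p else I π' p)
    (testTy π πR) nm.test T

/-- The interpretation with the value `⊥` for the auxiliary predicates. -/
noncomputable def AuxNames.erase (π πR : PTy) (I : Interp U N) : Interp U N :=
  open Classical in fun π₁ p => if (π₁, p) ∈ nm.syms π πR then ⊥ else I π₁ p

/-- The auxiliary predicates other than `test` have the intended meaning. -/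
def AuxNames.IsCanon (π πR : PTy) (I : Interp U N) : Prop :=
  ∀ q ∈ nm.syms π πR, q ≠ (testTy π πR, nm.test) → I q.1 q.2 = nm.canon πR q.1 q.2

variable {nm} {π πR : PTy}

theorem AuxNames.test_mem : (testTy π πR, nm.test) ∈ nm.syms π πR :=
  Or.inl (Or.inl (Or.inl rfl))

theorem AuxNames.empty_mem : (πR, nm.empty) ∈ nm.syms π πR :=
  Or.inl (Or.inl (Or.inr (Or.inl rfl)))

theorem AuxNames.add_mem : (addTy πR, nm.add) ∈ nm.syms π πR :=
  Or.inl (Or.inl (Or.inr (Or.inr rfl)))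

theorem AuxNames.eq_mem {ρ : ATy} (h : ρ ∈ πR.args) : (eqTy ρ, nm.eq) ∈ nm.syms π πR :=
  Or.inl (Or.inr ⟨ρ, h, rfl⟩)

theorem AuxNames.neq_mem {π' : PTy} (h : .pred π' ∈ πR.args) :
    (eqTy (.pred π'), nm.neq) ∈ nm.syms π πR :=
  Or.inr ⟨π', h, rfl⟩

theorem AuxNames.isCanon_iff {I : Interp U N} : nm.IsCanon π πR I ↔
    I πR nm.empty = ⊥ ∧ I (addTy πR) nm.add = πR.addVal ∧
      (∀ ρ ∈ πR.args, I (eqTy ρ) nm.eq = PTy.eqVal _) ∧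
      (∀ π', .pred π' ∈ πR.args → I (eqTy (.pred π')) nm.neq = PTy.neqVal _) := by
  obtain ⟨h₁, h₂, h₃, h₄, -⟩ := nm.ne
  constructor
  · refine fun h => ⟨?_, ?_, fun ρ hρ => ?_, fun π' hπ' => ?_⟩
    · rw [h _ empty_mem fun e => h₁ (Prod.mk.inj e).2.symm, nm.canon_empty]
    · rw [h _ add_mem fun e => h₂ (Prod.mk.inj e).2.symm, nm.canon_add]
    · rw [h _ (eq_mem hρ) fun e => h₃ (Prod.mk.inj e).2.symm, nm.canon_eq]
    · rw [h _ (neq_mem hπ') fun e => h₄ (Prod.mk.inj e).2.symm, nm.canon_neq]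
  · rintro ⟨he, ha, hq, hn⟩ q (((rfl | rfl | rfl) | ⟨ρ, hρ, rfl⟩) | ⟨π', hπ', rfl⟩) hne
    · exact absurd rfl hne
    · rw [he, nm.canon_empty]
    · rw [ha, nm.canon_add]
    · rw [hq ρ hρ, nm.canon_eq]
    · rw [hn π' hπ', nm.canon_neq]

theorem AuxNames.extend_test (I : Interp U N) (T : PTy.sem U (testTy π πR)) :
    nm.extend π πR I T (testTy π πR) nm.test = T :=
  Interp.set_self ..

theorem AuxNames.extend_of_notMem (I : Interp U N) (T : PTy.sem U (testTy π πR)) {π' : PTy}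
    {p : N} (h : (π', p) ∉ nm.syms π πR) : nm.extend π πR I T π' p = I π' p := by
  rw [AuxNames.extend, Interp.set_of_ne _ _ fun e => h (by rw [e]; exact test_mem), if_neg h]

theorem AuxNames.isCanon_extend (I : Interp U N) (T : PTy.sem U (testTy π πR)) :
    nm.IsCanon π πR (nm.extend π πR I T) := fun q hq hne => by
  rw [AuxNames.extend, Interp.set_of_ne _ _ hne, if_pos hq]

theorem AuxNames.erase_of_mem (I : Interp U N) {π' : PTy} {p : N}
    (h : (π', p) ∈ nm.syms π πR) : nm.erase π πR I π' p = ⊥ :=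
  if_pos h

theorem AuxNames.erase_of_notMem (I : Interp U N) {π' : PTy} {p : N}
    (h : (π', p) ∉ nm.syms π πR) : nm.erase π πR I π' p = I π' p :=
  if_neg h

theorem AuxNames.eq_extend {I I' : Interp U N} {T : PTy.sem U (testTy π πR)}
    (hc : nm.IsCanon π πR I) (ht : I (testTy π πR) nm.test = T)
    (h : ∀ π' p, (π', p) ∉ nm.syms π πR → I π' p = I' π' p) : I = nm.extend π πR I' T := by
  funext π' p
  by_cases hq : (π', p) ∈ nm.syms π πR
  · by_cases hne : (π', p) = (testTy π πR, nm.test)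
    · cases hne
      rw [ht, extend_test]
    · rw [hc _ hq hne, isCanon_extend _ _ _ hq hne]
  · rw [h _ _ hq, extend_of_notMem _ _ hq]

theorem AuxNames.extend_erase {I : Interp U N} (hc : nm.IsCanon π πR I) :
    nm.extend π πR (nm.erase π πR I) (I (testTy π πR) nm.test) = I :=
  (eq_extend hc rfl fun _ _ h => (erase_of_notMem I h).symm).symm

/-- Two extensions share the intended values, so these drop out of the comparison. Through this
equivalence precision is both preserved and reflected. -/
theorem AuxNames.extend_le_extend {I I' : Interp U N} {T T' : PTy.sem U (testTy π πR)} :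
    nm.extend π πR I T ≤ nm.extend π πR I' T' ↔
      (∀ π' p, (π', p) ∉ nm.syms π πR → I π' p ≤ I' π' p) ∧ T ≤ T' := by
  constructor
  · refine fun h => ⟨fun π' p hq => ?_, ?_⟩
    · have := h π' p
      rwa [extend_of_notMem _ _ hq, extend_of_notMem _ _ hq] at this
    · have := h (testTy π πR) nm.test
      rwa [extend_test, extend_test] at this
  · rintro ⟨h, hT⟩ π' p
    by_cases hq : (π', p) ∈ nm.syms π πR
    · by_cases hne : (π', p) = (testTy π πR, nm.test)
      · cases hne
        rwa [extend_test, extend_test]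
      · exact (isCanon_extend I T _ hq hne).trans (isCanon_extend I' T' _ hq hne).symm |>.le
    · rw [extend_of_notMem _ _ hq, extend_of_notMem _ _ hq]
      exact h _ _ hq

theorem AuxNames.IsCanon.of_le_of_le {I J K : Interp U N} (hI : nm.IsCanon π πR I)
    (hK : nm.IsCanon π πR K) (hIJ : I ≤ J) (hJK : J ≤ K) : nm.IsCanon π πR J := fun q hq hne =>
  le_antisymm ((hJK q.1 q.2).trans (hK q hq hne).le) ((hI q hq hne).ge.trans (hIJ q.1 q.2))

/-- Applied to interpretations produced by the original program, which has no rules for the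
auxiliary predicates, and to erased ones. -/
theorem AuxNames.le_iff_of_bot {I I' : Interp U N}
    (hI : ∀ π' p, (π', p) ∈ nm.syms π πR → I π' p = ⊥) :
    I ≤ I' ↔ ∀ π' p, (π', p) ∉ nm.syms π πR → I π' p ≤ I' π' p := by
  refine ⟨fun h π' p _ => h π' p, fun h π' p => ?_⟩
  by_cases hq : (π', p) ∈ nm.syms π πR
  · rw [hI _ _ hq]
    exact bot_le
  · exact h _ _ hq

end Canonical

/-! ## The operator of the transformed program -/

section NewRules

variable {C N : Type} {U : Set C} {nm : AuxNames N} {r : Rule C N} {πR : PTy} {R : ℕ}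
  {hR : (ATy.pred πR, R) ∉ r.params.vars}

theorem Rule.not_fires_of_ne {b : Bool} {I J : Interp U N} {ρ : Rule C N} {π : PTy} {p : N}
    {d : PTy.Tuple U π} (h : p ≠ ρ.name) : ¬ ρ.Fires b I J π p d := fun hf =>
  h (Prod.mk.inj hf.head_eq).2

/-- The rule `p X₁ ⋯ Xₘ ← test X₁ ⋯ Xₘ empty`. -/
def headRule (nm : AuxNames N) (r : Rule C N) (πR : PTy) : Rule C N :=
  ⟨r.ty, r.name, r.params, r.nodup,
    [.pos (.app (Expr.apps (.arr (.pred πR) .o) (.sym (testTy r.ty πR) nm.test) r.params)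
      (.sym πR nm.empty))]⟩

/-- The rule `test X₁ ⋯ Xₘ R ← B`. -/
def bodyRule (nm : AuxNames N) (r : Rule C N) (πR : PTy) (R : ℕ)
    (hR : (ATy.pred πR, R) ∉ r.params.vars) : Rule C N :=
  ⟨testTy r.ty πR, nm.test, r.params.append (.cons R .nil), nodup_testParams r.nodup hR, r.body⟩

/-- The rule `test X₁ ⋯ Xₘ R ← test X₁ ⋯ Xₘ (add R Z₁ ⋯ Zₙ)`. -/
def stepRule (nm : AuxNames N) (r : Rule C N) (πR : PTy) (R : ℕ)
    (hR : (ATy.pred πR, R) ∉ r.params.vars) : Rule C N :=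
  ⟨testTy r.ty πR, nm.test, r.params.append (.cons R .nil), nodup_testParams r.nodup hR,
    [.pos (.app (Expr.apps (.arr (.pred πR) .o) (.sym (testTy r.ty πR) nm.test) r.params)
      (Expr.apps πR (.app (.sym (addTy πR) nm.add) (.var (.pred πR) R))
        (Params.enum πR
          (r.params.append (.cons R .nil : Params (.arr (.pred πR) .o))).bound)))]⟩

theorem exists_newRules_fires (b : Bool) (I J : Interp U N) (π : PTy) (p : N)
    (d : PTy.Tuple U π) :
    (∃ ρ ∈ newRules nm r πR R hR, ρ.Fires b I J π p d) ↔
      (headRule nm r πR).Fires b I J π p d ∨ (bodyRule nm r πR R hR).Fires b I J π p d ∨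
      (stepRule nm r πR R hR).Fires b I J π p d ∨ (emptyRule nm πR).Fires b I J π p d ∨
      (∃ ρ ∈ addRules nm πR, ρ.Fires b I J π p d) ∨
      ∃ ρ ∈ πR.args, ∃ ρ' ∈ eqRules nm ρ, ρ'.Fires b I J π p d := by
  unfold newRules
  simp only [List.mem_append, List.mem_cons, List.not_mem_nil, or_false, List.mem_flatMap,
    or_and_right, exists_or, exists_eq_left, or_assoc]
  refine or_congr Iff.rfl (or_congr Iff.rfl (or_congr Iff.rfl (or_congr Iff.rfl
    (or_congr Iff.rfl ?_))))
  exact ⟨fun ⟨ρ', ⟨ρ, h, h'⟩, hf⟩ => ⟨ρ, h, ρ', h', hf⟩,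
    fun ⟨ρ, h, ρ', h', hf⟩ => ⟨ρ', ⟨ρ, h, h'⟩, hf⟩⟩

theorem name_of_mem_addRules {ρ : Rule C N} (h : ρ ∈ addRules nm πR) : ρ.name = nm.add := by
  simp only [addRules, List.mem_cons, List.not_mem_nil, or_false] at h
  rcases h with rfl | rfl <;> rfl

theorem head_of_mem_eqRules {ρ : ATy} {ρ' : Rule C N} (h : ρ' ∈ eqRules nm ρ) :
    ρ'.ty = eqTy ρ ∧ (ρ'.name = nm.eq ∨ ρ'.name = nm.neq) := by
  cases ρ with
  | iota =>
    simp only [eqRules, List.mem_cons, List.not_mem_nil, or_false] at h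
    subst h
    exact ⟨rfl, Or.inl rfl⟩
  | pred π =>
    simp only [eqRules, List.mem_cons, List.not_mem_nil, or_false] at h
    rcases h with rfl | rfl | rfl
    exacts [⟨rfl, Or.inl rfl⟩, ⟨rfl, Or.inr rfl⟩, ⟨rfl, Or.inr rfl⟩]

theorem not_addRules_fires {b : Bool} {I J : Interp U N} {π : PTy} {p : N}
    {d : PTy.Tuple U π} (h : p ≠ nm.add) :
    ¬ ∃ ρ ∈ addRules nm πR, ρ.Fires b I J π p d := fun ⟨_, hρ, hf⟩ =>
  Rule.not_fires_of_ne (name_of_mem_addRules hρ ▸ h) hf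

theorem not_eqRules_fires {b : Bool} {I J : Interp U N} {π : PTy} {p : N}
    {d : PTy.Tuple U π} (h : p ≠ nm.eq) (h' : p ≠ nm.neq) :
    ¬ ∃ ρ ∈ πR.args, ∃ ρ' ∈ eqRules nm ρ, ρ'.Fires b I J π p d := fun ⟨_, _, _, hρ', hf⟩ => by
  rcases (head_of_mem_eqRules hρ').2 with e | e
  exacts [Rule.not_fires_of_ne (e ▸ h) hf, Rule.not_fires_of_ne (e ▸ h') hf]

theorem eqRules_fires_iff {b : Bool} {I J : Interp U N} {ρ : ATy} {p : N}
    {d : PTy.Tuple U (eqTy ρ)} (hρ : ρ ∈ πR.args) :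
    (∃ ρ ∈ πR.args, ∃ ρ' ∈ eqRules nm ρ, ρ'.Fires b I J (eqTy _) p d) ↔
      ∃ ρ' ∈ eqRules nm ρ, ρ'.Fires b I J (eqTy ρ) p d := by
  refine ⟨fun ⟨ρ₁, _, ρ', hρ', hf⟩ => ?_, fun h => ⟨ρ, hρ, h⟩⟩
  have h₁ := (head_of_mem_eqRules hρ').1
  have h₂ := (Prod.mk.inj hf.head_eq).1
  rw [h₁] at h₂
  cases h₂
  exact ⟨ρ', hρ', hf⟩

variable {Q P' : Program C N}

/-- `P'` consists of the rules of `Q` and the rules that replace `r`, and the auxiliary predicates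
are new. -/
structure IsTransformed (nm : AuxNames N) (r : Rule C N) (πR : PTy) (R : ℕ)
    (hR : (ATy.pred πR, R) ∉ r.params.vars) (Q P' : Program C N) : Prop where
  mem_iff : ∀ ρ, ρ ∈ P' ↔ ρ ∈ Q ∨ ρ ∈ newRules nm r πR R hR
  fresh : ∀ q ∈ nm.syms r.ty πR, q ∉ Q.syms ∧ q ∉ r.syms

variable (h : IsTransformed nm r πR R hR Q P')
include h

theorem IsTransformed.holds_approx (b : Bool) (I J : Interp U N) (π : PTy) (p : N)
    (d : PTy.Tuple U π) : PTy.holds (sel b (P'.approx U I J) π p) d ↔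
      (∃ ρ ∈ Q, ρ.Fires b I J π p d) ∨ ∃ ρ ∈ newRules nm r πR R hR, ρ.Fires b I J π p d := by
  simp only [Program.holds_approx, h.mem_iff, or_and_right, exists_or]

/-- By freshness, neither a rule of `Q` nor the new rule for the head predicate of `r` has an
auxiliary predicate in its head. -/
theorem IsTransformed.holds_approx_of_mem (b : Bool) (I J : Interp U N) {π : PTy} {p : N}
    (hq : (π, p) ∈ nm.syms r.ty πR) (d : PTy.Tuple U π) :
    PTy.holds (sel b (P'.approx U I J) π p) d ↔
      (bodyRule nm r πR R hR).Fires b I J π p d ∨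
      (stepRule nm r πR R hR).Fires b I J π p d ∨ (emptyRule nm πR).Fires b I J π p d ∨
      (∃ ρ ∈ addRules nm πR, ρ.Fires b I J π p d) ∨
      ∃ ρ ∈ πR.args, ∃ ρ' ∈ eqRules nm ρ, ρ'.Fires b I J π p d := by
  obtain ⟨h₁, h₂⟩ := h.fresh _ hq
  rw [h.holds_approx, exists_newRules_fires, or_iff_right, or_iff_right]
  · exact fun hf => h₂ (Or.inl hf.head_eq)
  · exact fun ⟨ρ, hρ, hf⟩ => h₁ ⟨ρ, hρ, Or.inl hf.head_eq⟩

/-- All new rules except `headRule` have auxiliary heads. -/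
theorem IsTransformed.approx_of_notMem (b : Bool) (I J : Interp U N) {π : PTy} {p : N}
    (hq : (π, p) ∉ nm.syms r.ty πR) (d : PTy.Tuple U π) :
    PTy.holds (sel b (P'.approx U I J) π p) d ↔
      (∃ ρ ∈ Q, ρ.Fires b I J π p d) ∨ (headRule nm r πR).Fires b I J π p d := by
  rw [h.holds_approx, exists_newRules_fires]
  refine or_congr Iff.rfl (or_iff_left ?_)
  rintro (hf | hf | hf | ⟨ρ, hρ, hf⟩ | ⟨ρ, hρ, ρ', hρ', hf⟩)
  · exact hq (hf.head_eq ▸ AuxNames.test_mem)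
  · exact hq (hf.head_eq ▸ AuxNames.test_mem)
  · exact hq (hf.head_eq ▸ AuxNames.empty_mem)
  · simp only [addRules, List.mem_cons, List.not_mem_nil, or_false] at hρ
    rcases hρ with rfl | rfl <;> exact hq (hf.head_eq ▸ AuxNames.add_mem)
  · cases ρ with
    | iota =>
      simp only [eqRules, List.mem_cons, List.not_mem_nil, or_false] at hρ'
      subst hρ'
      exact hq (hf.head_eq ▸ AuxNames.eq_mem hρ)
    | pred π' =>
      simp only [eqRules, List.mem_cons, List.not_mem_nil, or_false] at hρ'
      rcases hρ' with rfl | rfl | rfl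
      · exact hq (hf.head_eq ▸ AuxNames.eq_mem hρ)
      · exact hq (hf.head_eq ▸ AuxNames.neq_mem hρ)
      · exact hq (hf.head_eq ▸ AuxNames.neq_mem hρ)

theorem IsTransformed.approx_empty (b : Bool) (I J : Interp U N) :
    sel b (P'.approx U I J) πR nm.empty = ⊥ := by
  obtain ⟨h₁, h₂, h₃, h₄, h₅, h₆, h₇, -⟩ := nm.ne
  refine PTy.sem_ext fun d => iff_of_false ?_ (PTy.holds_bot d)
  rw [h.holds_approx_of_mem b I J AuxNames.empty_mem]
  rintro (hf | hf | hf | hf | hf)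
  · exact Rule.not_fires_of_ne (ρ := bodyRule nm r πR R hR) h₁.symm hf
  · exact Rule.not_fires_of_ne (ρ := stepRule nm r πR R hR) h₁.symm hf
  · obtain ⟨s, -, hs⟩ := (Rule.fires_mk ..).1 hf
    have := (sel_bodyEval ..).1 hs _ (List.mem_singleton_self _)
    cases b <;> exact this rfl
  · exact not_addRules_fires h₅ hf
  · exact not_eqRules_fires h₆ h₇ hf

end NewRules

-- Exactness of the auxiliary predicates other than `test`

section Exactness

variable {C N : Type} {U : Set C} {nm : AuxNames N} {r : Rule C N} {πR : PTy} {R : ℕ}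
  {hR : (ATy.pred πR, R) ∉ r.params.vars} {Q P' : Program C N}

theorem sel_eval_pos (b : Bool) {I J : Interp U N} {s : State U} {E : Expr C N (.pred .o)}
    {x y : PTy.sem U .o} (h : E.eval I J s = (x, y)) :
    sel b ((Lit.pos E).eval I J s) ↔ (sel b (x, y) : PTy.sem U .o) :=
  iff_of_eq (congrArg (sel b) h)

theorem sel_eval_app_app (b : Bool) (I J : Interp U N) (s : State U) {ρ : ATy} (p : N)
    (x y : ℕ) : sel b ((Lit.pos (.app (.app (.sym (eqTy ρ) p) (.var ρ x))
      (.var ρ y)) : Lit C N).eval I J s) ↔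
        PTy.holds (sel b (I, J) (eqTy ρ) p) (PTy.Tuple.pair (s ρ x) (s ρ y)) := by
  refine (sel_eval_pos b (Expr.eval_app_of_exact (ρ := ρ) (π := .o) I J s
      (.app (.sym (eqTy ρ) p) (.var ρ x)) (v := s ρ y) rfl)).trans ?_
  rw [Expr.eval_app_of_exact (ρ := ρ) (π := .arr ρ .o) I J s
      (.sym (eqTy ρ) p) (v := s ρ x) rfl]
  cases b <;> exact Iff.rfl

/-- Negation exchanges the two components; this is the source of every `!b` below. -/
theorem sel_eval_neg (b : Bool) (I J : Interp U N) (s : State U) (E : Expr C N (.pred .o)) :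
    sel b ((Lit.neg E).eval I J s) ↔ ¬ sel (!b) ((Lit.pos E).eval I J s) := by
  cases b <;> exact Iff.rfl

theorem sel_eval_appAll_var (b : Bool) (I J : Interp U N) (s : State U) {π : PTy} (x : ℕ)
    (X : Params π) : sel b ((Lit.pos (Expr.appAll (.var (.pred π) x) X) : Lit C N).eval I J s) ↔
      PTy.holds (s (.pred π) x) (X.eval s) := by
  refine (sel_eval_pos b (Expr.eval_appAll I J s _ X)).trans ?_
  cases b <;> exact Iff.rfl

theorem eval_pair {s : State U} {ρ : ATy} {a c : ATy.sem U ρ} :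
    (Params.cons 0 (.cons 1 .nil) : Params (eqTy ρ)).eval s = PTy.Tuple.pair a c ↔
      s ρ 0 = a ∧ s ρ 1 = c :=
  PTy.Tuple.pair_inj

theorem fires_pair (b : Bool) (I J : Interp U N) {ρ : ATy} (p : N)
    (B : List (Lit C N)) (a c : ATy.sem U ρ) :
    (⟨eqTy ρ, p, .cons 0 (.cons 1 .nil), nodup_pair ρ, B⟩ : Rule C N).Fires b I J (eqTy ρ) p
      (PTy.Tuple.pair a c) ↔
        ∃ s : State U, s ρ 0 = a ∧ s ρ 1 = c ∧ ∀ L ∈ B, sel b (L.eval I J s) := by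
  rw [Rule.fires_mk]
  simp only [sel_bodyEval, eval_pair, and_assoc]

theorem exists_state_pair [Nonempty U] {ρ : ATy} (a c : ATy.sem U ρ) :
    ∃ s : State U, s ρ 0 = a ∧ s ρ 1 = c := by
  obtain ⟨s₀⟩ := State.nonempty U
  obtain ⟨s, hs⟩ := Params.exists_eval_eq s₀ _ (nodup_pair ρ) (PTy.Tuple.pair a c)
  exact ⟨s, eval_pair.1 hs⟩

variable (h : IsTransformed nm r πR R hR Q P')

include h

theorem IsTransformed.holds_approx_eq_neq (b : Bool) (I J : Interp U N) {ρ : ATy}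
    (hρ : ρ ∈ πR.args) {p : N} (hp : p = nm.eq ∨ p = nm.neq)
    (hq : (eqTy ρ, p) ∈ nm.syms r.ty πR) (d : PTy.Tuple U (eqTy ρ)) :
    PTy.holds (sel b (P'.approx U I J) (eqTy ρ) p) d ↔
      ∃ ρ' ∈ eqRules nm ρ, ρ'.Fires b I J (eqTy ρ) p d := by
  obtain ⟨-, -, h₁, h₂, -, h₃, h₄, h₅, h₆, -⟩ := nm.ne
  have hn : p ≠ nm.test ∧ p ≠ nm.empty ∧ p ≠ nm.add := by
    rcases hp with rfl | rfl
    exacts [⟨h₁.symm, h₃.symm, h₅.symm⟩, ⟨h₂.symm, h₄.symm, h₆.symm⟩]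
  rw [h.holds_approx_of_mem b I J hq, eqRules_fires_iff hρ,
    or_iff_right (Rule.not_fires_of_ne (ρ := bodyRule nm r πR R hR) hn.1),
    or_iff_right (Rule.not_fires_of_ne (ρ := stepRule nm r πR R hR) hn.1),
    or_iff_right (Rule.not_fires_of_ne (ρ := emptyRule nm πR) hn.2.1),
    or_iff_right (not_addRules_fires hn.2.2)]

variable [Nonempty U]

/-- The bodies for `neq` mention only variables, whose values are exact. So one application of the
operator to any pair yields true inequality, by extensionality of relations. -/
theorem IsTransformed.approx_neq (b : Bool) (I J : Interp U N) {π : PTy}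
    (hπ : .pred π ∈ πR.args) :
    sel b (P'.approx U I J) (eqTy (.pred π)) nm.neq = PTy.neqVal _ := by
  have hne := nm.ne.2.2.2.2.2.2.2.2.2
  refine PTy.sem_ext fun ⟨a, c, _⟩ => ?_
  change PTy.holds _ (PTy.Tuple.pair a c) ↔ PTy.holds _ (PTy.Tuple.pair a c)
  rw [h.holds_approx_eq_neq b I J hπ (Or.inr rfl) (AuxNames.neq_mem hπ), PTy.holds_neqVal]
  simp only [eqRules, List.mem_cons, List.not_mem_nil, or_false, or_and_right, exists_or,
    exists_eq_left]
  rw [or_iff_right (Rule.not_fires_of_ne hne.symm), fires_pair, fires_pair]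
  simp only [List.mem_cons, List.not_mem_nil, or_false, forall_eq_or_imp, forall_eq,
    sel_eval_neg, sel_eval_appAll_var]
  constructor
  · rintro (⟨s, rfl, rfl, h₁, h₂⟩ | ⟨s, rfl, rfl, h₁, h₂⟩) e
    · exact h₂ (e ▸ h₁)
    · exact h₁ (e ▸ h₂)
  · intro hac
    have hex : ∃ v, ¬ (PTy.holds (π := π) a v ↔ PTy.holds (π := π) c v) := by
      by_contra hcon
      push Not at hcon
      exact hac (PTy.sem_ext (π := π) hcon)
    obtain ⟨v, hv⟩ := hex
    obtain ⟨s₀⟩ := State.nonempty U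
    -- The variables `Z`, `Y`, `V̄` are numbered `0, 1, 2, …`, so one state can realise `a`, `c` and
    -- the separating tuple `v` together.
    have hnd : (Params.cons 0 (.cons 1 (Params.enum π 2)) :
        Params (.arr (.pred π) (.arr (.pred π) π))).vars.Nodup := by
      refine List.Nodup.of_map Prod.snd ?_
      simp only [Params.vars, List.map_cons, Params.map_snd_vars_enum]
      exact List.nodup_range' (s := 0) (n := π.args.length + 2)
    obtain ⟨s, hs⟩ := Params.exists_eval_eq s₀ _ hnd (a, c, v)
    have h₀ : s (.pred π) 0 = a := congrArg Prod.fst hs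
    have h₁ : s (.pred π) 1 = c := congrArg (fun x => x.2.1) hs
    have h₂ : (Params.enum π 2).eval s = v := congrArg (fun x => x.2.2) hs
    by_cases hav : PTy.holds (π := π) a v
    · refine Or.inl ⟨s, h₀, h₁, ?_⟩
      rw [h₀, h₁, h₂]
      exact ⟨hav, fun hc => hv (iff_of_true hav hc)⟩
    · refine Or.inr ⟨s, h₀, h₁, ?_⟩
      rw [h₀, h₁, h₂]
      exact ⟨hav, by_contra fun hc => hv (iff_of_false hav hc)⟩

/-- At predicate types `eq` is a negated `neq`, so its component `b` reads the opposite component of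
`neq`. At type `ι` the rule uses `≈` and needs no assumption. -/
theorem IsTransformed.approx_eq (b : Bool) (I J : Interp U N)
    (hneq : ∀ π, .pred π ∈ πR.args →
      sel (!b) (I, J) (eqTy (.pred π)) nm.neq = PTy.neqVal _) {ρ : ATy} (hρ : ρ ∈ πR.args) :
    sel b (P'.approx U I J) (eqTy ρ) nm.eq = PTy.eqVal _ := by
  have hne := nm.ne.2.2.2.2.2.2.2.2.2
  refine PTy.sem_ext fun ⟨a, c, _⟩ => ?_
  change PTy.holds _ (PTy.Tuple.pair a c) ↔ PTy.holds _ (PTy.Tuple.pair a c)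
  rw [h.holds_approx_eq_neq b I J hρ (Or.inl rfl) (AuxNames.eq_mem hρ), PTy.holds_eqVal]
  cases ρ with
  | iota =>
    simp only [eqRules, List.mem_cons, List.not_mem_nil, or_false, exists_eq_left]
    rw [fires_pair]
    simp only [List.mem_cons, List.not_mem_nil, or_false, forall_eq]
    have key : ∀ s : State U, sel b ((Lit.eq (.var .iota 0) (.var .iota 1) : Lit C N).eval I J s)
        ↔ s .iota 0 = s .iota 1 := fun s => by
      have : (s .iota 0, s .iota 0) = (s .iota 1, s .iota 1) ↔ s .iota 0 = s .iota 1 :=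
        ⟨fun e => (Prod.mk.inj e).1, fun e => by rw [e]⟩
      cases b <;> exact this
    constructor
    · rintro ⟨s, rfl, rfl, hs⟩
      exact (key s).1 hs
    · intro hac
      obtain ⟨s, h₀, h₁⟩ := exists_state_pair a c
      exact ⟨s, h₀, h₁, (key s).2 (by rw [h₀, h₁, hac])⟩
  | pred π =>
    simp only [eqRules, List.mem_cons, List.not_mem_nil, or_false, or_and_right, exists_or,
      exists_eq_left]
    rw [or_iff_left (by
      rintro (hf | hf)
      exacts [Rule.not_fires_of_ne hne hf, Rule.not_fires_of_ne hne hf]), fires_pair]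
    simp only [List.mem_cons, List.not_mem_nil, or_false, forall_eq, sel_eval_neg,
      sel_eval_app_app, hneq π hρ, PTy.holds_neqVal, not_not]
    constructor
    · rintro ⟨s, rfl, rfl, hs⟩
      exact hs
    · intro hac
      obtain ⟨s, h₀, h₁⟩ := exists_state_pair a c
      exact ⟨s, h₀, h₁, by rw [h₀, h₁, hac]⟩

omit h [Nonempty U] in
theorem eqLits_eval (b : Bool) (I J : Interp U N) (s : State U) : ∀ {π : PTy} (Z Y : Params π),
    (∀ ρ ∈ π.args, sel b (I, J) (eqTy ρ) nm.eq = PTy.eqVal _) →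
    ((∀ L ∈ eqLits nm Z Y, sel b ((L : Lit C N).eval I J s)) ↔ Z.eval s = Y.eval s)
  | _, .nil, .nil, _ => 
    iff_of_true (fun _ h => absurd h List.not_mem_nil) rfl
  | .arr ρ π, .cons z Z, .cons y Y, heq => by
    have ih := eqLits_eval b I J s Z Y fun ρ' hρ' => heq ρ' (List.mem_cons_of_mem _ hρ')
    simp only [eqLits, List.forall_mem_cons, ih, sel_eval_app_app]
    rw [heq ρ (List.mem_cons_self ..), PTy.holds_eqVal]
    constructor
    · rintro ⟨h₁, h₂⟩
      exact Prod.ext h₁ h₂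
    · intro e
      exact ⟨congrArg Prod.fst e, congrArg Prod.snd e⟩

/-- Since `eq` occurs positively here, only its component `b` matters. With true equality the second
rule adds exactly the tuple `z`, the first one keeps `v`. -/
theorem IsTransformed.approx_add (b : Bool) (I J : Interp U N)
    (heq : ∀ ρ ∈ πR.args, sel b (I, J) (eqTy ρ) nm.eq = PTy.eqVal _) :
    sel b (P'.approx U I J) (addTy πR) nm.add = PTy.addVal πR := by
  obtain ⟨-, h₁, -, -, h₂, -, -, h₃, h₄, -⟩ := nm.ne
  refine PTy.sem_ext fun ⟨v, e⟩ => ?_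
  obtain ⟨z, y, rfl⟩ := PTy.Tuple.exists_append e
  change PTy.holds _ (PTy.Tuple.addArgs v z y) ↔ PTy.holds _ (PTy.Tuple.addArgs v z y)
  have hval : PTy.holds (PTy.addVal (U := U) πR) (PTy.Tuple.addArgs v z y) ↔
      PTy.holds (π := πR) v y ∨ z = y := by
    refine (PTy.holds_append (PTy.lam (PTy.adjoin v)) z y).trans ?_
    rw [PTy.applyT_lam]
    exact PTy.holds_adjoin (π := πR) v z y
  rw [hval, h.holds_approx_of_mem b I J AuxNames.add_mem,
    or_iff_right (Rule.not_fires_of_ne (ρ := bodyRule nm r πR R hR) h₁.symm),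
    or_iff_right (Rule.not_fires_of_ne (ρ := stepRule nm r πR R hR) h₁.symm),
    or_iff_right (Rule.not_fires_of_ne (ρ := emptyRule nm πR) h₂.symm),
    or_iff_left (not_eqRules_fires h₃ h₄)]
  simp only [addRules, List.mem_cons, List.not_mem_nil, or_false, or_and_right, exists_or,
    exists_eq_left, Rule.fires_mk, sel_bodyEval, forall_eq, sel_eval_appAll_var]
  have key : ∀ s : State U, (addParams πR).eval s = PTy.Tuple.addArgs v z y ↔
      s (.pred πR) 0 = v ∧ (Params.enum πR 1).eval s = z ∧
        (Params.enum πR (1 + πR.args.length)).eval s = y := fun s => by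
    rw [← PTy.Tuple.append_inj, ← Params.eval_append]
    exact ⟨fun e => ⟨congrArg Prod.fst e, congrArg Prod.snd e⟩, fun e => Prod.ext e.1 e.2⟩
  simp only [key, eqLits_eval b I J _ _ _ heq]
  obtain ⟨s₀⟩ := State.nonempty U
  obtain ⟨s, hs⟩ := Params.exists_eval_eq s₀ _ (nodup_addParams πR) (PTy.Tuple.addArgs v z y)
  rw [key] at hs
  constructor
  · rintro (⟨s, ⟨rfl, rfl, rfl⟩, ht⟩ | ⟨s, ⟨rfl, rfl, rfl⟩, ht⟩)
    exacts [Or.inl ht, Or.inr ht]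
  · rintro (hv | hz)
    · exact Or.inl ⟨s, hs, by rwa [hs.1, hs.2.2]⟩
    · exact Or.inr ⟨s, hs, by rw [hs.2.1, hs.2.2, hz]⟩

/-- The operator produces the intended meaning of the auxiliary predicates other than `test` from
itself. -/
theorem IsTransformed.isCanon_approx (b : Bool) {I J : Interp U N}
    (hI : nm.IsCanon r.ty πR I) (hJ : nm.IsCanon r.ty πR J) :
    nm.IsCanon r.ty πR (sel b (P'.approx U I J)) := by
  have hb : ∀ b, nm.IsCanon r.ty πR (sel b (I, J)) := fun b => by cases b <;> assumption
  exact AuxNames.isCanon_iff.2 ⟨h.approx_empty b I J,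
    h.approx_add b I J (AuxNames.isCanon_iff.1 (hb b)).2.2.1,
    fun ρ hρ => h.approx_eq b I J (AuxNames.isCanon_iff.1 (hb _)).2.2.2 hρ,
    fun π hπ => h.approx_neq b I J hπ⟩

/-- The definitions are stratified: `neq` is forced outright, then `eq` in both components, then
`add`. -/
theorem IsTransformed.isCanon_of_fixpoint {I J : Interp U N} (hfix : P'.approx U I J = (I, J)) :
    nm.IsCanon r.ty πR I ∧ nm.IsCanon r.ty πR J := by
  have hn : ∀ b π, .pred π ∈ πR.args →
      sel b (I, J) (eqTy (.pred π)) nm.neq = PTy.neqVal _ := fun b π hπ => by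
    rw [← h.approx_neq b I J hπ, hfix]
  have he : ∀ b, ∀ ρ ∈ πR.args, sel b (I, J) (eqTy ρ) nm.eq = PTy.eqVal _ := fun b ρ hρ => by
    rw [← h.approx_eq b I J (hn _) hρ, hfix]
  have key : ∀ b, nm.IsCanon r.ty πR (sel b (I, J)) := fun b =>
    AuxNames.isCanon_iff.2 ⟨by rw [← h.approx_empty b I J, hfix],
      by rw [← h.approx_add b I J (he b), hfix], he b, hn b⟩
  exact ⟨key false, key true⟩

/-- The first component needs the second one only. -/
theorem IsTransformed.isCanon_of_prefixpoint {I J x : Interp U N}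
    (hI : nm.IsCanon r.ty πR I) (hJ : nm.IsCanon r.ty πR J) (hx : x ≤ I)
    (hpre : (P'.approx U x J).1 ≤ x) : nm.IsCanon r.ty πR x := by
  -- Squeezing: a prefixpoint lies above what the operator produces, and `x` lies below `I`. The
  -- strata can thus be settled one after another, with `eq` read off from `neq` in `J`.
  have hsq : ∀ π p, I π p = (P'.approx U x J).1 π p → x π p = I π p := fun π p e =>
    le_antisymm (hx π p) (e.le.trans (hpre π p))
  obtain ⟨i₁, i₂, i₃, i₄⟩ := AuxNames.isCanon_iff.1 hI
  have hn : ∀ π, .pred π ∈ πR.args → x (eqTy (.pred π)) nm.neq = PTy.neqVal _ := fun π hπ => by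
    rw [hsq _ _ ((i₄ π hπ).trans (h.approx_neq false x J hπ).symm), i₄ π hπ]
  have he : ∀ ρ ∈ πR.args, x (eqTy ρ) nm.eq = PTy.eqVal _ := fun ρ hρ => by
    rw [hsq _ _ ((i₃ ρ hρ).trans
      (h.approx_eq false x J (AuxNames.isCanon_iff.1 hJ).2.2.2 hρ).symm), i₃ ρ hρ]
  exact AuxNames.isCanon_iff.2 ⟨by rw [hsq _ _ (i₁.trans (h.approx_empty false x J).symm), i₁],
    by rw [hsq _ _ (i₂.trans (h.approx_add false x J he).symm), i₂], he, hn⟩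

end Exactness

/-! ## The rules for `test` -/

section Test

variable {C N : Type} {U : Set C} {nm : AuxNames N} {r : Rule C N} {πR : PTy} {R : ℕ}
  {hR : (ATy.pred πR, R) ∉ r.params.vars} {Q P' : Program C N}

/-- The body of `r` is true for the arguments `d` and the value `v` of `R`. -/
def Rule.BodyHolds (b : Bool) (I J : Interp U N) (r : Rule C N) (πR : PTy) (R : ℕ)
    (d : PTy.Tuple U r.ty) (v : PTy.sem U πR) : Prop :=
  ∃ s : State U, r.params.eval s = d ∧ s (.pred πR) R = v ∧ sel b (bodyEval I J s r.body)

/-- The body of `r` is true for the arguments `d` and some value `v' ≥ v` of `R`. -/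
def Rule.bodyEx (b : Bool) (I J : Interp U N) (r : Rule C N) (πR : PTy) (R : ℕ) :
    PTy.sem U (testTy r.ty πR) :=
  testMk fun d v => ∃ v', v ≤ v' ∧ r.BodyHolds b I J πR R d v'

theorem Rule.testHolds_bodyEx {b : Bool} {I J : Interp U N} {d : PTy.Tuple U r.ty}
    {v : PTy.sem U πR} : testHolds (r.bodyEx b I J πR R) d v ↔
      ∃ v', v ≤ v' ∧ r.BodyHolds b I J πR R d v' :=
  testHolds_mk _ _ _

/-- A state that satisfies the body already chooses a value of `R`, and the condition `⊥ ≤ v'`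
excludes no value. -/
theorem Rule.fires_self_iff (b : Bool) (I J : Interp U N) (d : PTy.Tuple U r.ty) :
    r.Fires b I J r.ty r.name d ↔ testHolds (r.bodyEx b I J πR R) d ⊥ := by
  rw [Rule.testHolds_bodyEx]
  refine (Rule.fires_mk b I J r.params r.nodup r.body d).trans ?_
  constructor
  · rintro ⟨s, hs, hB⟩
    exact ⟨_, bot_le, s, hs, rfl, hB⟩
  · rintro ⟨_, -, s, hs, -, hB⟩
    exact ⟨s, hs, hB⟩

theorem eval_testX (I J : Interp U N) (s : State U) {E : Expr C N (.pred πR)}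
    {v : PTy.sem U πR} (hE : E.eval I J s = (v, v)) (b : Bool) :
    sel b ((Lit.pos (.app (Expr.apps (.arr (.pred πR) .o) (.sym (testTy r.ty πR) nm.test)
      r.params) E)).eval I J s) ↔
      testHolds (sel b (I, J) (testTy r.ty πR) nm.test) (r.params.eval s) v := by
  refine (sel_eval_pos b (Expr.eval_app_of_exact I J s _ hE)).trans ?_
  rw [Expr.eval_apps]
  cases b <;> exact Iff.rfl

theorem headRule_fires_iff [Nonempty U] (b : Bool) {I J : Interp U N}
    (hI : nm.IsCanon r.ty πR I) (hJ : nm.IsCanon r.ty πR J) (d : PTy.Tuple U r.ty) :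
    (headRule nm r πR).Fires b I J r.ty r.name d ↔
      testHolds (sel b (I, J) (testTy r.ty πR) nm.test) d ⊥ := by
  have hE : ∀ s : State U, (Expr.sym πR nm.empty : Expr C N (.pred πR)).eval I J s =
      ((⊥ : PTy.sem U πR), (⊥ : PTy.sem U πR)) := fun s =>
    Prod.ext (AuxNames.isCanon_iff.1 hI).1 (AuxNames.isCanon_iff.1 hJ).1
  unfold headRule
  simp only [Rule.fires_mk, sel_bodyEval, List.mem_singleton, forall_eq, eval_testX I J _ (hE _)]
  obtain ⟨s₀⟩ := State.nonempty U
  obtain ⟨s, hs⟩ := Params.exists_eval_eq s₀ _ r.nodup d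
  exact ⟨fun ⟨s, hs, ht⟩ => hs ▸ ht, fun ht => ⟨s, hs, hs ▸ ht⟩⟩

theorem eval_append_single {π : PTy} (X : Params π) (s : State U) (d : PTy.Tuple U π)
    (v : PTy.sem U πR) :
    (X.append (.cons R .nil : Params (.arr (.pred πR) .o))).eval s =
      d.snoc v ↔ X.eval s = d ∧ s (.pred πR) R = v := by
  rw [Params.eval_append]
  refine PTy.Tuple.append_inj.trans ?_
  refine and_congr_right fun _ => ⟨fun e => congrArg Prod.fst e, fun e => Prod.ext e rfl⟩

theorem bodyRule_fires_iff (b : Bool) (I J : Interp U N) (d : PTy.Tuple U r.ty)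
    (v : PTy.sem U πR) : (bodyRule nm r πR R hR).Fires b I J (testTy r.ty πR) nm.test
      (d.snoc v) ↔ r.BodyHolds b I J πR R d v := by
  unfold bodyRule Rule.BodyHolds
  simp only [Rule.fires_mk, eval_append_single, and_assoc]

/-- The argument `add R Z̄` is exact with value `PTy.adjoin v z`, and `z` ranges over all tuples
because the variables `Z̄` are fresh for the head. -/
theorem stepRule_fires_iff [Nonempty U] (b : Bool) {I J : Interp U N}
    (hI : nm.IsCanon r.ty πR I) (hJ : nm.IsCanon r.ty πR J) (d : PTy.Tuple U r.ty)
    (v : PTy.sem U πR) : (stepRule nm r πR R hR).Fires b I J (testTy r.ty πR) nm.test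
      (d.snoc v) ↔
        ∃ z, testHolds (sel b (I, J) (testTy r.ty πR) nm.test) d (PTy.adjoin v z) := by
  have hE : ∀ (s : State U) (Z : Params πR),
      (Expr.apps πR (.app (.sym (addTy πR) nm.add) (.var (.pred πR) R)) Z :
        Expr C N (.pred πR)).eval I J s =
      ((PTy.adjoin (s (.pred πR) R) (Z.eval s) : PTy.sem U πR),
        (PTy.adjoin (s (.pred πR) R) (Z.eval s) : PTy.sem U πR)) := fun s Z => by
    rw [Expr.eval_apps, Expr.eval_app_of_exact (ρ := .pred πR) (π := πR.append πR) I J s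
      (.sym (addTy πR) nm.add) (v := s (.pred πR) R) rfl]
    have key : ∀ {K : Interp U N}, nm.IsCanon r.ty πR K → PTy.applyT (π := πR) (π' := πR)
        ((K (addTy πR) nm.add : ATy.sem U (.pred πR) → PTy.sem U (πR.append πR))
          (s (.pred πR) R)) (Z.eval s) = PTy.adjoin (s (.pred πR) R) (Z.eval s) := fun {K} hK => by
      rw [(AuxNames.isCanon_iff.1 hK).2.1]
      exact PTy.applyT_lam (PTy.adjoin _) _
    exact Prod.ext (key hI) (key hJ)
  unfold stepRule
  simp only [Rule.fires_mk, sel_bodyEval, List.mem_singleton, forall_eq,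
    eval_testX I J _ (hE _ _), eval_append_single]
  constructor
  · rintro ⟨s, ⟨rfl, rfl⟩, ht⟩
    exact ⟨_, ht⟩
  · rintro ⟨z, ht⟩
    obtain ⟨s₀⟩ := State.nonempty U
    obtain ⟨s, hs⟩ := Params.exists_eval_eq s₀ _
      (Params.nodup_append_enum (π' := πR) (nodup_testParams r.nodup hR) le_rfl)
      ((d.snoc v).append z)
    rw [Params.eval_append, PTy.Tuple.append_inj, eval_append_single] at hs
    refine ⟨s, hs.1, ?_⟩
    rw [hs.1.1, hs.1.2, hs.2]
    exact ht

/-- This is the recursion that governs `test`. On the right, `test` itself is read in component `b`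
only, which lets the two components be treated separately. -/
theorem IsTransformed.approx_test [Nonempty U] (h : IsTransformed nm r πR R hR Q P') (b : Bool)
    {I J : Interp U N} (hI : nm.IsCanon r.ty πR I) (hJ : nm.IsCanon r.ty πR J)
    (d : PTy.Tuple U r.ty) (v : PTy.sem U πR) :
    testHolds (sel b (P'.approx U I J) (testTy r.ty πR) nm.test) d v ↔
      r.BodyHolds b I J πR R d v ∨
        ∃ z, testHolds (sel b (I, J) (testTy r.ty πR) nm.test) d (PTy.adjoin v z) := by
  obtain ⟨h₁, h₂, h₃, h₄, -⟩ := nm.ne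
  have := h.holds_approx_of_mem b I J AuxNames.test_mem
    (d.snoc v)
  rw [holds_snoc, bodyRule_fires_iff, stepRule_fires_iff b hI hJ,
    or_iff_left (a := ∃ z, _) (by
      rintro (hf | hf | hf)
      exacts [Rule.not_fires_of_ne (ρ := emptyRule nm πR) h₁ hf, not_addRules_fires h₂ hf,
        not_eqRules_fires h₃ h₄ hf])] at this
  exact this

/-- Relations closed under the removal of a tuple from the last argument are closed under the
passage to a smaller relation. -/
theorem of_le_of_adjoin [Finite U] {π : PTy} {S : PTy.sem U π → Prop}
    (hS : ∀ v z, S (PTy.adjoin v z) → S v) {v v' : PTy.sem U π} (hv : v ≤ v') (h : S v') :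
    S v := by
  have := PTy.finite_tuple U π
  -- Induction on a finite set `A` of tuples of `v'` containing those that `v` lacks; each step
  -- adjoins one of them to `v`.
  have key : ∀ A : Set (PTy.Tuple U π), A.Finite → A ⊆ {z | PTy.holds v' z} →
      ∀ v ≤ v', (∀ z, PTy.holds v' z → PTy.holds v z ∨ z ∈ A) → S v := by
    intro A hA
    induction A, hA using Set.Finite.induction_on with
    | empty =>
      intro _ v hv hz
      have : v = v' := le_antisymm hv (PTy.le_iff.2 fun z hz' => (hz z hz').resolve_right id)
      exact this ▸ h
    | @insert a A _ _ ih =>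
      intro hA v hv hz
      refine hS v a (ih ((Set.subset_insert a A).trans hA) _ ?_ fun z hz' => ?_)
      · refine PTy.le_iff.2 fun z hz => ?_
        rcases (PTy.holds_adjoin v a z).1 hz with hz | rfl
        · exact PTy.le_iff.1 hv z hz
        · exact hA (Set.mem_insert _ _)
      · rw [PTy.holds_adjoin]
        rcases hz z hz' with hz | rfl | hz
        exacts [Or.inl (Or.inl hz), Or.inl (Or.inr rfl), Or.inr hz]
  exact key _ (Set.toFinite _) subset_rfl v hv fun z hz => Or.inr hz

/-- Minimality of `bodyEx` among the solutions of the recursion for `test`. Finiteness of the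
universe is essential: tuples are removed one at a time. -/
theorem Rule.bodyEx_le_of_closed [Finite U] {b : Bool} {I J : Interp U N}
    {T : PTy.sem U (testTy r.ty πR)}
    (h₁ : ∀ d v, r.BodyHolds b I J πR R d v → testHolds T d v)
    (h₂ : ∀ d v z, testHolds T d (PTy.adjoin v z) → testHolds T d v) :
    r.bodyEx b I J πR R ≤ T := by
  refine testTy_le_iff.2 fun d v hv => ?_
  obtain ⟨v', hvv', hv'⟩ := Rule.testHolds_bodyEx.1 hv
  exact of_le_of_adjoin (h₂ d) hvv' (h₁ d v' hv')

/-- The relation `bodyEx` solves the recursion for `test`: a witness `v' ≥ v` either equals `v`, or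
has a further tuple `z` and is then above `v ∪ {z}`. -/
theorem Rule.testHolds_bodyEx_iff {b : Bool} {I J : Interp U N} {d : PTy.Tuple U r.ty}
    {v : PTy.sem U πR} : testHolds (r.bodyEx b I J πR R) d v ↔
      r.BodyHolds b I J πR R d v ∨
        ∃ z, testHolds (r.bodyEx b I J πR R) d (PTy.adjoin v z) := by
  simp only [Rule.testHolds_bodyEx]
  constructor
  · rintro ⟨v', hv, hv'⟩
    by_cases hz : ∃ z, PTy.holds v' z ∧ ¬ PTy.holds v z
    · obtain ⟨z, hz, -⟩ := hz
      refine Or.inr ⟨z, v', PTy.le_iff.2 fun y hy => ?_, hv'⟩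
      rcases (PTy.holds_adjoin v z y).1 hy with hy | rfl
      exacts [PTy.le_iff.1 hv y hy, hz]
    · push Not at hz
      rw [le_antisymm hv (PTy.le_iff.2 hz)]
      exact Or.inl hv'
  · rintro (hv | ⟨z, v', hv, hv'⟩)
    · exact ⟨v, le_rfl, hv⟩
    · exact ⟨v', (PTy.le_adjoin v z).trans hv, hv'⟩

theorem Rule.bodyHolds_congr {b : Bool} {I I' J J' : Interp U N}
    (h : ∀ q ∈ r.syms, I q.1 q.2 = I' q.1 q.2 ∧ J q.1 q.2 = J' q.1 q.2)
    (d : PTy.Tuple U r.ty) (v : PTy.sem U πR) :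
    r.BodyHolds b I J πR R d v ↔ r.BodyHolds b I' J' πR R d v := by
  unfold Rule.BodyHolds
  refine exists_congr fun s => ?_
  rw [bodyEval_congr s fun L hL q hq => h q (Or.inr ⟨L, hL, hq⟩)]

theorem Rule.bodyEx_mono {I I' J J' : Interp U N} (hI : I ≤ I') (hIJ : I' ≤ J') (hJ : J' ≤ J) :
    r.bodyEx false I J πR R ≤ r.bodyEx false I' J' πR R ∧
      r.bodyEx false I' J' πR R ≤ r.bodyEx true I' J' πR R ∧
      r.bodyEx true I' J' πR R ≤ r.bodyEx true I J πR R := by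
  refine ⟨testTy_le_iff.2 fun d v hv => ?_, testTy_le_iff.2 fun d v hv => ?_,
    testTy_le_iff.2 fun d v hv => ?_⟩
  all_goals
    rw [Rule.testHolds_bodyEx] at hv ⊢
    obtain ⟨v', hv, s, hs, hs', hB⟩ := hv
    obtain ⟨h₁, h₂, h₃⟩ := bodyEval_mono hI hIJ hJ s r.body
    refine ⟨v', hv, s, hs, hs', ?_⟩
  exacts [h₁ hB, h₂ hB, h₃ hB]

theorem Rule.bodyEx_self (I : Interp U N) :
    r.bodyEx true I I πR R = r.bodyEx false I I πR R := by
  have : ∀ d v, r.BodyHolds true I I πR R d v ↔ r.BodyHolds false I I πR R d v := fun d v =>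
    exists_congr fun s => and_congr_right fun _ => and_congr_right fun _ =>
      bodyEval_self true I s r.body
  unfold Rule.bodyEx
  simp only [this]

end Test

/-! ## Stable fixpoints -/

/-- Operators on pairs that preserve consistency and are monotone for precision. -/
def IsApproximating {L : Type*} [Preorder L] (A : L → L → L × L) : Prop :=
  ∀ {I I' J J' : L}, I ≤ I' → I' ≤ J' → J' ≤ J →
    (A I J).1 ≤ (A I' J').1 ∧ (A I' J').1 ≤ (A I' J').2 ∧ (A I' J').2 ≤ (A I J).2

/-- Knaster–Tarski for the two monotone maps. The gain is that minimality is tested only on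
prefixpoints bounded by the fixpoint itself, for which the auxiliary predicates can be controlled.
-/
theorem isStableFixpoint_iff {L : Type*} [CompleteLattice L] {A : L → L → L × L}
    (hA : IsApproximating A) {I J : L} :
    IsStableFixpoint A I J ↔ I ≤ J ∧ A I J = (I, J) ∧
      (∀ x ≤ I, (A x J).1 ≤ x → I ≤ x) ∧ ∀ y, I ≤ y → y ≤ J → (A I y).2 ≤ y → J ≤ y := by
  constructor
  · rintro ⟨hIJ, ⟨⟨-, hI⟩, hIl⟩, ⟨⟨-, hJ⟩, hJl⟩⟩
    refine ⟨hIJ, Prod.ext hI hJ, fun x hx hpre => ?_, fun y hy hyJ hpre => ?_⟩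
    · set S := {z | z ≤ x ∧ (A z J).1 ≤ z}
      have hxJ : x ≤ J := hx.trans hIJ
      have hm : sInf S ≤ x := sInf_le ⟨le_rfl, hpre⟩
      have h₁ : (A (sInf S) J).1 ≤ sInf S := le_sInf fun z hz =>
        (hA (sInf_le hz) (hz.1.trans hxJ) le_rfl).1.trans hz.2
      have h₂ : sInf S ≤ (A (sInf S) J).1 :=
        sInf_le ⟨h₁.trans hm, (hA h₁ (hm.trans hxJ) le_rfl).1⟩
      exact (hIl ⟨hm.trans hxJ, le_antisymm h₁ h₂⟩).trans hm
    · set S := {z | I ≤ z ∧ z ≤ y ∧ (A I z).2 ≤ z}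
      have hm : sInf S ≤ y := sInf_le ⟨hy, le_rfl, hpre⟩
      have hIm : I ≤ sInf S := le_sInf fun z hz => hz.1
      have h₁ : (A I (sInf S)).2 ≤ sInf S := le_sInf fun z hz =>
        (hA le_rfl hIm (sInf_le hz)).2.2.trans hz.2.2
      -- The map `A(I, ·)₂` keeps the interval above `I`: `I = A(I, J)₁ ≤ A(I, m)₁ ≤ A(I, m)₂` for
      -- the infimum `m`.
      have h₀ : I ≤ (A I (sInf S)).2 := by
        obtain ⟨h₃, h₄, -⟩ := hA le_rfl hIm (hm.trans hyJ)
        exact hI.ge.trans (h₃.trans h₄)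
      have h₂ : sInf S ≤ (A I (sInf S)).2 :=
        sInf_le ⟨h₀, h₁.trans hm, (hA le_rfl h₀ h₁).2.2⟩
      exact (hJl ⟨hIm, le_antisymm h₁ h₂⟩).trans hm
  · rintro ⟨hIJ, hfix, hI, hJ⟩
    have h₁ : (A I J).1 = I := congrArg Prod.fst hfix
    have h₂ : (A I J).2 = J := congrArg Prod.snd hfix
    refine ⟨hIJ, ⟨⟨hIJ, h₁⟩, fun x ⟨hxJ, hx⟩ => ?_⟩, ⟨⟨hIJ, h₂⟩, fun y ⟨hIy, hy⟩ => ?_⟩⟩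
    -- A competing fixpoint need not lie below `I`, but its meet with `I` is a prefixpoint that
    -- does.
    · refine (hI (x ⊓ I) inf_le_right (le_inf ?_ ?_)).trans inf_le_left
      · exact (hA inf_le_left hxJ le_rfl).1.trans hx.le
      · exact (hA inf_le_right hIJ le_rfl).1.trans h₁.le
    · have hIz : I ≤ y ⊓ J := le_inf hIy hIJ
      refine (hJ (y ⊓ J) hIz inf_le_right (le_inf ?_ ?_)).trans inf_le_left
      · exact (hA le_rfl hIz inf_le_left).2.2.trans hy.le
      · exact (hA le_rfl hIz inf_le_right).2.2.trans h₂.le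

theorem Program.isApproximating {C N : Type} (P : Program C N) (U : Set C) :
    IsApproximating (P.approx U) := fun hI hIJ hJ => P.approx_mono hI hIJ hJ

-- Correspondence between the stable fixpoints of `P` and `P'`

section Correspondence

variable {C N : Type} {U : Set C} {nm : AuxNames N} {r : Rule C N} {πR : PTy} {R : ℕ}
  {hR : (ATy.pred πR, R) ∉ r.params.vars} {Q P P' : Program C N}

variable (h : IsTransformed nm r πR R hR Q P') (hP : ∀ ρ, ρ ∈ P ↔ ρ ∈ Q ∨ ρ = r)
include h hP

omit hP in
theorem IsTransformed.agree_of_mem {I I' J J' : Interp U N}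
    (hI : ∀ π p, (π, p) ∉ nm.syms r.ty πR → I π p = I' π p)
    (hJ : ∀ π p, (π, p) ∉ nm.syms r.ty πR → J π p = J' π p) {ρ : Rule C N}
    (hρ : ρ ∈ Q ∨ ρ = r) : ∀ q ∈ ρ.syms, I q.1 q.2 = I' q.1 q.2 ∧ J q.1 q.2 = J' q.1 q.2 := by
  intro q hq
  have hq' : (q.1, q.2) ∉ nm.syms r.ty πR := fun hmem => by
    obtain ⟨h₁, h₂⟩ := h.fresh _ hmem
    rcases hρ with hρ | rfl
    exacts [h₁ ⟨ρ, hρ, hq⟩, h₂ hq]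
  exact ⟨hI _ _ hq', hJ _ _ hq'⟩

theorem IsTransformed.approx_of_mem (b : Bool) (I J : Interp U N) {π : PTy} {p : N}
    (hq : (π, p) ∈ nm.syms r.ty πR) : sel b (P.approx U I J) π p = ⊥ := by
  refine PTy.sem_ext fun d => iff_of_false (fun hd => ?_) (PTy.holds_bot d)
  obtain ⟨ρ, hρ, hf⟩ := (P.holds_approx b I J π p d).1 hd
  obtain ⟨h₁, h₂⟩ := h.fresh _ hq
  rcases (hP ρ).1 hρ with hρ | rfl
  exacts [h₁ ⟨ρ, hρ, Or.inl hf.head_eq⟩, h₂ (Or.inl hf.head_eq)]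

theorem IsTransformed.holds_approx_old (b : Bool) {I I' J J' : Interp U N}
    (hI : ∀ π p, (π, p) ∉ nm.syms r.ty πR → I π p = I' π p)
    (hJ : ∀ π p, (π, p) ∉ nm.syms r.ty πR → J π p = J' π p) (π : PTy) (p : N)
    (d : PTy.Tuple U π) : PTy.holds (sel b (P.approx U I J) π p) d ↔
      (∃ ρ ∈ Q, ρ.Fires b I' J' π p d) ∨ r.Fires b I J π p d := by
  simp only [Program.holds_approx, hP, or_and_right, exists_or, exists_eq_left]
  refine or_congr_left (exists_congr fun ρ => and_congr_right fun hρ => ?_)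
  exact Rule.fires_congr (h.agree_of_mem hI hJ (Or.inl hρ))

variable [Nonempty U]

/-- If `test` contains `bodyEx`, then whatever `r` derives is derived by the new rule for its head
predicate. Only component `b` of `test` is involved. -/
theorem IsTransformed.approx_le (b : Bool) {I I' J J' : Interp U N}
    (hI : ∀ π p, (π, p) ∉ nm.syms r.ty πR → I π p = I' π p)
    (hJ : ∀ π p, (π, p) ∉ nm.syms r.ty πR → J π p = J' π p)
    (hI' : nm.IsCanon r.ty πR I') (hJ' : nm.IsCanon r.ty πR J')
    (hT : r.bodyEx b I J πR R ≤ sel b (I', J') (testTy r.ty πR) nm.test) {π : PTy} {p : N}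
    (hq : (π, p) ∉ nm.syms r.ty πR) :
    sel b (P.approx U I J) π p ≤ sel b (P'.approx U I' J') π p := by
  refine PTy.le_iff.2 fun d hd => ?_
  rw [h.holds_approx_old hP b hI hJ] at hd
  rw [h.approx_of_notMem b I' J' hq]
  refine hd.imp_right fun hf => ?_
  obtain ⟨rfl, rfl⟩ := Prod.mk.inj hf.head_eq
  rw [headRule_fires_iff b hI' hJ']
  exact testTy_le_iff.1 hT _ _ ((Rule.fires_self_iff b I J d).1 hf)

/-- When `test` is `bodyEx`, it reproduces itself by the recursion, and `test` at `⊥` is the rule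
`r`. So the operator of `P'` acts as that of `P` beneath the extension. -/
theorem IsTransformed.approx_eq_extend (b : Bool) {I I' J J' : Interp U N}
    (hI : ∀ π p, (π, p) ∉ nm.syms r.ty πR → I π p = I' π p)
    (hJ : ∀ π p, (π, p) ∉ nm.syms r.ty πR → J π p = J' π p)
    (hI' : nm.IsCanon r.ty πR I') (hJ' : nm.IsCanon r.ty πR J')
    (hT : sel b (I', J') (testTy r.ty πR) nm.test = r.bodyEx b I J πR R) :
    sel b (P'.approx U I' J') =
      nm.extend r.ty πR (sel b (P.approx U I J)) (r.bodyEx b I J πR R) := by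
  refine AuxNames.eq_extend (h.isCanon_approx b hI' hJ') ?_ fun π p hq => le_antisymm ?_
    (h.approx_le hP b hI hJ hI' hJ' hT.ge hq)
  · have key : ∀ d v, testHolds (sel b (P'.approx U I' J') (testTy r.ty πR) nm.test) d v ↔
        testHolds (r.bodyEx b I J πR R) d v := fun d v => by
      rw [h.approx_test b hI' hJ', hT, Rule.testHolds_bodyEx_iff,
        Rule.bodyHolds_congr (h.agree_of_mem hI hJ (Or.inr rfl))]
    exact le_antisymm (testTy_le_iff.2 fun d v => (key d v).1)
      (testTy_le_iff.2 fun d v => (key d v).2)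
  · refine PTy.le_iff.2 fun d hd => ?_
    rw [h.approx_of_notMem b I' J' hq] at hd
    rw [h.holds_approx_old hP b hI hJ]
    refine hd.imp_right fun hf => ?_
    obtain ⟨rfl, rfl⟩ : π = r.ty ∧ p = r.name := Prod.mk.inj hf.head_eq
    rw [headRule_fires_iff b hI' hJ', hT] at hf
    exact (Rule.fires_self_iff b I J d).2 hf

/-- A prefixpoint is closed under both rules for `test`, so its `test` contains `bodyEx`; its
remaining part is then a prefixpoint for `P`. -/
theorem IsTransformed.of_prefixpoint [Finite U] (b : Bool) {I I' J J' : Interp U N}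
    (hI : ∀ π p, (π, p) ∉ nm.syms r.ty πR → I π p = I' π p)
    (hJ : ∀ π p, (π, p) ∉ nm.syms r.ty πR → J π p = J' π p)
    (hI' : nm.IsCanon r.ty πR I') (hJ' : nm.IsCanon r.ty πR J')
    (hpre : sel b (P'.approx U I' J') ≤ sel b (I', J')) :
    r.bodyEx b I J πR R ≤ sel b (I', J') (testTy r.ty πR) nm.test ∧
      ∀ π p, (π, p) ∉ nm.syms r.ty πR → sel b (P.approx U I J) π p ≤ sel b (I', J') π p := by
  have ht := fun d v => (h.approx_test b hI' hJ' d v).2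
  have ht' := testTy_le_iff.1 (hpre (testTy r.ty πR) nm.test)
  have hT : r.bodyEx b I J πR R ≤ sel b (I', J') (testTy r.ty πR) nm.test := by
    refine Rule.bodyEx_le_of_closed (fun d v hd => ht' d v (ht d v (Or.inl ?_)))
      fun d v z hz => ht' d v (ht d v (Or.inr ⟨z, hz⟩))
    exact (Rule.bodyHolds_congr (h.agree_of_mem hI hJ (Or.inr rfl)) d v).1 hd
  exact ⟨hT, fun π p hq => (h.approx_le hP b hI hJ hI' hJ' hT hq).trans (hpre π p)⟩

/-- For minimality, a competing prefixpoint of `P'` has exact auxiliary predicates, and erasing them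
gives a competing prefixpoint of `P`. Minimality for `P` bounds this from below, and monotonicity of
`bodyEx` bounds `test`. -/
theorem IsTransformed.isStableFixpoint_extend [Finite U] {I J : Interp U N}
    (hs : IsStableFixpoint (P.approx U) I J) :
    IsStableFixpoint (P'.approx U) (nm.extend r.ty πR I (r.bodyEx false I J πR R))
      (nm.extend r.ty πR J (r.bodyEx true I J πR R)) := by
  obtain ⟨hIJ, hfix, hI, hJ⟩ := (isStableFixpoint_iff (P.isApproximating U)).1 hs
  set I' := nm.extend r.ty πR I (r.bodyEx false I J πR R) with hI'
  set J' := nm.extend r.ty πR J (r.bodyEx true I J πR R) with hJ'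
  have cI : nm.IsCanon r.ty πR I' := AuxNames.isCanon_extend _ _
  have cJ : nm.IsCanon r.ty πR J' := AuxNames.isCanon_extend _ _
  have aI : ∀ π p, (π, p) ∉ nm.syms r.ty πR → I π p = I' π p := fun π p hq =>
    (AuxNames.extend_of_notMem _ _ hq).symm
  have aJ : ∀ π p, (π, p) ∉ nm.syms r.ty πR → J π p = J' π p := fun π p hq =>
    (AuxNames.extend_of_notMem _ _ hq).symm
  have botI : ∀ π p, (π, p) ∈ nm.syms r.ty πR → I π p = ⊥ := fun π p hq => by
    have := h.approx_of_mem hP false I J hq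
    rwa [hfix] at this
  have botJ : ∀ π p, (π, p) ∈ nm.syms r.ty πR → J π p = ⊥ := fun π p hq => by
    have := h.approx_of_mem hP true I J hq
    rwa [hfix] at this
  rw [isStableFixpoint_iff (P'.isApproximating U)]
  refine ⟨?_, Prod.ext ?_ ?_, fun x hx hpre => ?_, fun y hy hyJ hpre => ?_⟩
  · exact AuxNames.extend_le_extend.2 ⟨fun π p _ => hIJ π p,
      (Rule.bodyEx_mono le_rfl hIJ le_rfl).2.1⟩
  · refine (h.approx_eq_extend hP false aI aJ cI cJ (AuxNames.extend_test ..)).trans ?_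
    rw [hfix]
    rfl
  · refine (h.approx_eq_extend hP true aI aJ cI cJ (AuxNames.extend_test ..)).trans ?_
    rw [hfix]
    rfl
  · have cx := h.isCanon_of_prefixpoint cI cJ hx hpre
    set x₀ := nm.erase r.ty πR x
    have ax : ∀ π p, (π, p) ∉ nm.syms r.ty πR → x₀ π p = x π p := fun π p hq =>
      AuxNames.erase_of_notMem _ hq
    obtain ⟨h₁, h₂⟩ := h.of_prefixpoint hP false ax aJ cx cJ hpre
    have hx₀ : x₀ ≤ I := (AuxNames.le_iff_of_bot fun π p hq => AuxNames.erase_of_mem _ hq).2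
      fun π p hq => (ax π p hq).le.trans ((hx π p).trans (aI π p hq).ge)
    have hle : I ≤ x₀ := hI x₀ hx₀ <| (AuxNames.le_iff_of_bot fun π p hq =>
      h.approx_of_mem hP false x₀ J hq).2 fun π p hq => (h₂ π p hq).trans (ax π p hq).ge
    rw [← AuxNames.extend_erase cx]
    refine AuxNames.extend_le_extend.2 ⟨fun π p _ => hle π p, le_trans ?_ h₁⟩
    exact (Rule.bodyEx_mono hle (hx₀.trans hIJ) le_rfl).1
  · have cy := cI.of_le_of_le cJ hy hyJ
    set y₀ := nm.erase r.ty πR y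
    have ay : ∀ π p, (π, p) ∉ nm.syms r.ty πR → y₀ π p = y π p := fun π p hq =>
      AuxNames.erase_of_notMem _ hq
    obtain ⟨h₁, h₂⟩ := h.of_prefixpoint hP true aI ay cI cy hpre
    have hy₀ : I ≤ y₀ := (AuxNames.le_iff_of_bot botI).2 fun π p hq =>
      (aI π p hq).le.trans ((hy π p).trans (ay π p hq).ge)
    have hy₀J : y₀ ≤ J := (AuxNames.le_iff_of_bot fun π p hq => AuxNames.erase_of_mem _ hq).2
      fun π p hq => (ay π p hq).le.trans ((hyJ π p).trans (aJ π p hq).ge)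
    have hle : J ≤ y₀ := hJ y₀ hy₀ hy₀J <| (AuxNames.le_iff_of_bot fun π p hq =>
      h.approx_of_mem hP true I y₀ hq).2 fun π p hq => (h₂ π p hq).trans (ay π p hq).ge
    rw [← AuxNames.extend_erase cy]
    refine AuxNames.extend_le_extend.2 ⟨fun π p _ => hle π p, le_trans ?_ h₁⟩
    rw [le_antisymm hle hy₀J]

/-- In a fixpoint `test` contains `bodyEx`, and resetting it to `bodyEx` leaves a prefixpoint; so
minimality in `P'` forces equality. Afterwards minimality for `P` follows by extending its
prefixpoints to `P'`. -/
theorem IsTransformed.exists_eq_extend [Finite U] {I' J' : Interp U N}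
    (hs : IsStableFixpoint (P'.approx U) I' J') :
    ∃ I J, IsStableFixpoint (P.approx U) I J ∧
      I' = nm.extend r.ty πR I (r.bodyEx false I J πR R) ∧
      J' = nm.extend r.ty πR J (r.bodyEx true I J πR R) := by
  obtain ⟨hIJ', hfix', hI', hJ'⟩ := (isStableFixpoint_iff (P'.isApproximating U)).1 hs
  obtain ⟨cI, cJ⟩ := h.isCanon_of_fixpoint hfix'
  set I := nm.erase r.ty πR I' with hIdef
  set J := nm.erase r.ty πR J' with hJdef
  have aI : ∀ π p, (π, p) ∉ nm.syms r.ty πR → I π p = I' π p := fun π p hq =>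
    AuxNames.erase_of_notMem _ hq
  have aJ : ∀ π p, (π, p) ∉ nm.syms r.ty πR → J π p = J' π p := fun π p hq =>
    AuxNames.erase_of_notMem _ hq
  have botI : ∀ π p, (π, p) ∈ nm.syms r.ty πR → I π p = ⊥ := fun π p hq =>
    AuxNames.erase_of_mem _ hq
  have botJ : ∀ π p, (π, p) ∈ nm.syms r.ty πR → J π p = ⊥ := fun π p hq =>
    AuxNames.erase_of_mem _ hq
  have hIJ : I ≤ J := (AuxNames.le_iff_of_bot botI).2 fun π p hq => by
    rw [aI π p hq, aJ π p hq]
    exact hIJ' π p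
  have eI := AuxNames.extend_erase cI
  have eJ := AuxNames.extend_erase cJ
  have hpre : ∀ b, sel b (P'.approx U I' J') ≤ sel b (I', J') := fun b => by rw [hfix']
  obtain ⟨t₁, n₁⟩ := h.of_prefixpoint hP false aI aJ cI cJ (hpre false)
  obtain ⟨t₂, n₂⟩ := h.of_prefixpoint hP true aI aJ cI cJ (hpre true)
  have hIe : I' = nm.extend r.ty πR I (r.bodyEx false I J πR R) := by
    have hle : nm.extend r.ty πR I (r.bodyEx false I J πR R) ≤ I' := by
      rw [← eI]
      exact AuxNames.extend_le_extend.2 ⟨fun π p _ => le_rfl, t₁⟩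
    refine le_antisymm (hI' _ hle ?_) hle
    refine (h.approx_eq_extend hP false (J := J) (J' := J')
      (fun π p hq => (AuxNames.extend_of_notMem _ _ hq).symm) aJ
      (AuxNames.isCanon_extend _ _) cJ (AuxNames.extend_test ..)).le.trans ?_
    exact AuxNames.extend_le_extend.2 ⟨fun π p hq => (n₁ π p hq).trans (aI π p hq).ge, le_rfl⟩
  have hJe : J' = nm.extend r.ty πR J (r.bodyEx true I J πR R) := by
    have hle : nm.extend r.ty πR J (r.bodyEx true I J πR R) ≤ J' := by
      rw [← eJ]
      exact AuxNames.extend_le_extend.2 ⟨fun π p _ => le_rfl, t₂⟩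
    have hge : I' ≤ nm.extend r.ty πR J (r.bodyEx true I J πR R) := by
      rw [hIe]
      exact AuxNames.extend_le_extend.2 ⟨fun π p _ => hIJ π p,
        (Rule.bodyEx_mono le_rfl hIJ le_rfl).2.1⟩
    refine le_antisymm (hJ' _ hge hle ?_) hle
    refine (h.approx_eq_extend hP true (I := I) (I' := I') aI
      (fun π p hq => (AuxNames.extend_of_notMem _ _ hq).symm)
      cI (AuxNames.isCanon_extend _ _) (AuxNames.extend_test ..)).le.trans ?_
    exact AuxNames.extend_le_extend.2 ⟨fun π p hq => (n₂ π p hq).trans (aJ π p hq).ge, le_rfl⟩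
  have hfix : ∀ b, sel b (P.approx U I J) = sel b (I, J) := fun b => by
    have hTb : sel b (I', J') (testTy r.ty πR) nm.test = r.bodyEx b I J πR R := by
      cases b
      · exact (congrFun (congrFun hIe _) _).trans (AuxNames.extend_test ..)
      · exact (congrFun (congrFun hJe _) _).trans (AuxNames.extend_test ..)
    have he := h.approx_eq_extend hP b aI aJ cI cJ hTb
    rw [hfix'] at he
    funext π p
    by_cases hq : (π, p) ∈ nm.syms r.ty πR
    · rw [h.approx_of_mem hP b I J hq]
      cases b
      exacts [(botI π p hq).symm, (botJ π p hq).symm]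
    · have := congrFun (congrFun he π) p
      rw [AuxNames.extend_of_notMem _ _ hq] at this
      rw [← this]
      cases b
      exacts [(aI π p hq).symm, (aJ π p hq).symm]
  refine ⟨I, J, (isStableFixpoint_iff (P.isApproximating U)).2
    ⟨hIJ, Prod.ext (hfix false) (hfix true), fun x hx hpre => ?_, fun y hy hyJ hpre => ?_⟩,
    hIe, hJe⟩
  -- A prefixpoint `x` of `P` becomes one of `P'` when `test` is computed from `x` itself.
  · have hle : nm.extend r.ty πR x (r.bodyEx false x J πR R) ≤ I' := by
      rw [hIe]
      exact AuxNames.extend_le_extend.2 ⟨fun π p _ => hx π p,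
        (Rule.bodyEx_mono hx hIJ le_rfl).1⟩
    have := hI' _ hle <| (h.approx_eq_extend hP false (J := J) (J' := J')
      (fun π p hq => (AuxNames.extend_of_notMem _ _ hq).symm) aJ
      (AuxNames.isCanon_extend _ _) cJ (AuxNames.extend_test ..)).le.trans
      (AuxNames.extend_le_extend.2 ⟨fun π p _ => hpre π p, le_rfl⟩)
    rw [hIe, AuxNames.extend_le_extend] at this
    exact (AuxNames.le_iff_of_bot botI).2 this.1
  · have hge : I' ≤ nm.extend r.ty πR y (r.bodyEx true I y πR R) := by
      rw [hIe]
      obtain ⟨h₁, h₂, -⟩ := Rule.bodyEx_mono (r := r) (πR := πR) (R := R) le_rfl hy hyJ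
      exact AuxNames.extend_le_extend.2 ⟨fun π p _ => hy π p, h₁.trans h₂⟩
    have hle : nm.extend r.ty πR y (r.bodyEx true I y πR R) ≤ J' := by
      rw [hJe]
      exact AuxNames.extend_le_extend.2 ⟨fun π p _ => hyJ π p,
        (Rule.bodyEx_mono le_rfl hy hyJ).2.2⟩
    have := hJ' _ hge hle <| (h.approx_eq_extend hP true (I := I) (I' := I') aI
      (fun π p hq => (AuxNames.extend_of_notMem _ _ hq).symm)
      cI (AuxNames.isCanon_extend _ _) (AuxNames.extend_test ..)).le.trans
      (AuxNames.extend_le_extend.2 ⟨fun π p _ => hpre π p, le_rfl⟩)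
    rw [hJe, AuxNames.extend_le_extend] at this
    exact (AuxNames.le_iff_of_bot botJ).2 this.1

end Correspondence

/-! ## Derived atoms -/

section Derives

variable {C N : Type} {U : Set C}

/-- `Program.Derives` with an arbitrary universe. -/
def Program.DerivesIn (P : Program C N) (U : Set C) (p : N) (as : List U) : Reading → Prop
  | .wellFounded => ∃ I J, (IsStableFixpoint (P.approx U) I J ∧
      ∀ I' J', IsStableFixpoint (P.approx U) I' J' → I ≤ I' ∧ J' ≤ J) ∧
      applyFO as (I (PTy.fo as.length) p)
  | .cautious => ∀ I, IsStableFixpoint (P.approx U) I I → applyFO as (I (PTy.fo as.length) p)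
  | .brave => ∃ I, IsStableFixpoint (P.approx U) I I ∧ applyFO as (I (PTy.fo as.length) p)

theorem Program.derives_iff (P : Program C N) (p : N) (as : List P.consts) (S : Reading) :
    P.Derives p as S ↔ P.DerivesIn P.consts p as S := by
  cases S <;> exact Iff.rfl

theorem Program.derivesIn_congr {P P' : Program C N} (h : P.approx U = P'.approx U) (p : N)
    (as : List U) (S : Reading) : P.DerivesIn U p as S ↔ P'.DerivesIn U p as S := by
  cases S <;> simp only [Program.DerivesIn, h]

theorem Program.approx_eq_of_fires {P P' : Program C N}
    (h : ∀ (b : Bool) (I J : Interp U N) (π : PTy) (p : N) (d : PTy.Tuple U π),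
      (∃ ρ ∈ P, ρ.Fires b I J π p d) ↔ ∃ ρ ∈ P', ρ.Fires b I J π p d) :
    P.approx U = P'.approx U := by
  have key : ∀ b I J, sel b (P.approx U I J) = sel b (P'.approx U I J) := fun b I J => by
    funext π p
    refine PTy.sem_ext fun d => ?_
    rw [Program.holds_approx, Program.holds_approx, h]
  funext I J
  exact Prod.ext (key false I J) (key true I J)

theorem Program.approx_eq_of_isEmpty [IsEmpty U] (P P' : Program C N) :
    P.approx U = P'.approx U := by
  have : ∀ (ρ : Rule C N) (b : Bool) (I J : Interp U N) (π : PTy) (p : N) (d : PTy.Tuple U π),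
      ¬ ρ.Fires b I J π p d := fun ρ b I J π p d ⟨_, _, _, _, s, _⟩ =>
    (State.isEmpty U).false s
  exact Program.approx_eq_of_fires fun b I J π p d => by simp only [this, and_false, exists_false]

variable {nm : AuxNames N} {r : Rule C N} {πR : PTy} {R : ℕ}
  {hR : (ATy.pred πR, R) ∉ r.params.vars} {Q P P' : Program C N}

/-- The correspondence of stable fixpoints preserves and reflects precision, carries two-valued ones
to two-valued ones in both directions, and does not touch the predicate `p`. -/
theorem IsTransformed.derivesIn_iff [Finite U] (h : IsTransformed nm r πR R hR Q P')
    (hP : ∀ ρ, ρ ∈ P ↔ ρ ∈ Q ∨ ρ = r) {p : N} {as : List U}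
    (hp : (PTy.fo as.length, p) ∉ nm.syms r.ty πR) (S : Reading) :
    P.DerivesIn U p as S ↔ P'.DerivesIn U p as S := by
  rcases isEmpty_or_nonempty U with hU | hU
  · exact Program.derivesIn_congr (Program.approx_eq_of_isEmpty P P') p as S
  have hext : ∀ (I : Interp U N) T,
      nm.extend r.ty πR I T (PTy.fo as.length) p = I (PTy.fo as.length) p := fun I T =>
    AuxNames.extend_of_notMem _ _ hp
  have hself : ∀ I : Interp U N, IsStableFixpoint (P.approx U) I I →
      IsStableFixpoint (P'.approx U) (nm.extend r.ty πR I (r.bodyEx false I I πR R))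
        (nm.extend r.ty πR I (r.bodyEx false I I πR R)) := fun I hs => by
    have := h.isStableFixpoint_extend hP hs
    rwa [Rule.bodyEx_self] at this
  have hbot : ∀ (b : Bool) {I J : Interp U N}, IsStableFixpoint (P.approx U) I J → ∀ π p,
      (π, p) ∈ nm.syms r.ty πR → sel b (I, J) π p = ⊥ := fun b I J hs π p hq => by
    have := h.approx_of_mem hP b I J hq
    rwa [((isStableFixpoint_iff (P.isApproximating U)).1 hs).2.1] at this
  have hself' : ∀ I' : Interp U N, IsStableFixpoint (P'.approx U) I' I' →
      ∃ I, IsStableFixpoint (P.approx U) I I ∧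
        I' = nm.extend r.ty πR I (r.bodyEx false I I πR R) := fun I' hs => by
    obtain ⟨I, J, hIJ, e₁, e₂⟩ := h.exists_eq_extend hP hs
    have hle : I = J := by
      refine le_antisymm hIJ.1 ((AuxNames.le_iff_of_bot (hbot true hIJ)).2 ?_)
      exact (AuxNames.extend_le_extend.1 (e₂.symm.trans e₁).le).1
    subst hle
    exact ⟨I, hIJ, e₁⟩
  cases S with
  | wellFounded =>
    constructor
    · rintro ⟨I, J, ⟨hs, hl⟩, ha⟩
      refine ⟨_, _, ⟨h.isStableFixpoint_extend hP hs, fun I' J' hs' => ?_⟩, by rwa [hext]⟩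
      obtain ⟨I₂, J₂, hs₂, rfl, rfl⟩ := h.exists_eq_extend hP hs'
      obtain ⟨h₁, h₂⟩ := hl I₂ J₂ hs₂
      obtain ⟨t₁, -, t₂⟩ := Rule.bodyEx_mono (r := r) (πR := πR) (R := R) h₁ hs₂.1 h₂
      exact ⟨AuxNames.extend_le_extend.2 ⟨fun π p _ => h₁ π p, t₁⟩,
        AuxNames.extend_le_extend.2 ⟨fun π p _ => h₂ π p, t₂⟩⟩
    · rintro ⟨I', J', ⟨hs', hl⟩, ha⟩
      obtain ⟨I, J, hs, rfl, rfl⟩ := h.exists_eq_extend hP hs'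
      refine ⟨I, J, ⟨hs, fun I₂ J₂ hs₂ => ?_⟩, by rwa [hext] at ha⟩
      obtain ⟨h₁, h₂⟩ := hl _ _ (h.isStableFixpoint_extend hP hs₂)
      exact ⟨(AuxNames.le_iff_of_bot (hbot false hs)).2 (AuxNames.extend_le_extend.1 h₁).1,
        (AuxNames.le_iff_of_bot (hbot true hs₂)).2 (AuxNames.extend_le_extend.1 h₂).1⟩
  | cautious =>
    constructor
    · intro ha I' hs'
      obtain ⟨I, hs, rfl⟩ := hself' I' hs'
      rw [hext]
      exact ha I hs
    · intro ha I hs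
      have := ha _ (hself I hs)
      rwa [hext] at this
  | brave =>
    constructor
    · rintro ⟨I, hs, ha⟩
      exact ⟨_, hself I hs, by rwa [hext]⟩
    · rintro ⟨I', hs', ha⟩
      obtain ⟨I, hs, rfl⟩ := hself' I' hs'
      exact ⟨I, hs, by rwa [hext] at ha⟩

end Derives

/-! ## Substitution for a variable of type `o` -/

section Substitution

variable {C N : Type} {U : Set C}

/-- The usual substitution lemma. It needs an exact value for `A`, because a state can give `R` only
a two-valued object. -/
theorem Expr.eval_substBool {I J : Interp U N} {s : State U} {R : ℕ} {A : Expr C N (.pred .o)}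
    {v : ATy.sem U (.pred .o)} (hA : A.eval I J s = (v, v)) : ∀ {ρ : ATy} (E : Expr C N ρ),
    (Expr.substBool R A E).eval I J s = E.eval I J (s.set (.pred .o) R v)
  | .iota, .var _ x => by
    have : s.set (.pred .o) R v .iota x = s .iota x :=
      State.set_of_ne _ _ fun h => ATy.noConfusion (Prod.mk.inj h).1
    exact Prod.ext this.symm this.symm
  | .pred (.arr ρ π), .var _ x => by
    have : s.set (.pred .o) R v (.pred (.arr ρ π)) x = s (.pred (.arr ρ π)) x :=
      State.set_of_ne _ _ fun h => by cases (Prod.mk.inj h).1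
    exact Prod.ext this.symm this.symm
  | .pred .o, .var _ x => by
    rw [Expr.substBool]
    by_cases hx : x = R
    · subst hx
      rw [if_pos rfl, hA]
      have := State.set_self s (.pred .o) x v
      exact Prod.ext this.symm this.symm
    · rw [if_neg hx]
      have : s.set (.pred .o) R v (.pred .o) x = s (.pred .o) x :=
        State.set_of_ne _ _ fun h => hx (Prod.mk.inj h).2
      exact Prod.ext this.symm this.symm
  | _, .cst c => by
    have : s.set (.pred .o) R v .iota 0 = s .iota 0 :=
      State.set_of_ne _ _ fun h => ATy.noConfusion (Prod.mk.inj h).1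
    simp only [Expr.substBool, Expr.eval, this]
  | _, .sym _ _ => by simp only [Expr.substBool, Expr.eval]
  | _, .app E F => by
    rw [Expr.substBool, Expr.eval, Expr.eval, Expr.eval_substBool hA E, Expr.eval_substBool hA F]

theorem Lit.eval_substBool {I J : Interp U N} {s : State U} {R : ℕ} {A : Expr C N (.pred .o)}
    {v : ATy.sem U (.pred .o)} (hA : A.eval I J s = (v, v)) (L : Lit C N) :
    (L.substBool R A).eval I J s = L.eval I J (s.set (.pred .o) R v) := by
  cases L with
  | pos E => exact Expr.eval_substBool hA E
  | _ => simp only [Lit.substBool, Lit.eval, Expr.eval_substBool hA]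

theorem Expr.consts_substBool {R : ℕ} {A : Expr C N (.pred .o)} (hA : A.consts = ∅) :
    ∀ {ρ : ATy} (E : Expr C N ρ), (Expr.substBool R A E).consts = E.consts
  | .iota, .var _ _ => rfl
  | .pred (.arr _ _), .var _ _ => rfl
  | .pred .o, .var _ x => by
    rw [Expr.substBool]
    split_ifs
    exacts [hA, rfl]
  | _, .cst _ => by simp only [Expr.substBool]
  | _, .sym _ _ => by simp only [Expr.substBool]
  | _, .app E F => by
    rw [Expr.substBool, Expr.consts, Expr.consts, Expr.consts_substBool hA E,
      Expr.consts_substBool hA F]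

theorem Expr.syms_substBool {R : ℕ} {A : Expr C N (.pred .o)} (hA : A.syms = ∅) :
    ∀ {ρ : ATy} (E : Expr C N ρ), (Expr.substBool R A E).syms = E.syms
  | .iota, .var _ _ => rfl
  | .pred (.arr _ _), .var _ _ => rfl
  | .pred .o, .var _ x => by
    rw [Expr.substBool]
    split_ifs
    exacts [hA, rfl]
  | _, .cst _ => by simp only [Expr.substBool]
  | _, .sym _ _ => by simp only [Expr.substBool]
  | _, .app E F => by
    rw [Expr.substBool, Expr.syms, Expr.syms, Expr.syms_substBool hA E, Expr.syms_substBool hA F]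

theorem Lit.consts_substBool {R : ℕ} {A : Expr C N (.pred .o)} (hA : A.consts = ∅)
    (L : Lit C N) : (L.substBool R A).consts = L.consts := by
  cases L <;> simp only [Lit.substBool, Lit.consts, Expr.consts_substBool hA]

theorem Lit.syms_substBool {R : ℕ} {A : Expr C N (.pred .o)} (hA : A.syms = ∅)
    (L : Lit C N) : (L.substBool R A).syms = L.syms := by
  cases L <;> simp only [Lit.substBool, Lit.syms, Expr.syms_substBool hA]

/-- The expression `F W`. -/
abbrev guardExpr (C N : Type) (F W : ℕ) : Expr C N (.pred .o) :=
  .app (.var (.pred (.arr .iota .o)) F) (.var .iota W)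

/-- The rule `r` with `F W` in place of the variable `R` of type `o`. -/
abbrev Rule.guard (r : Rule C N) (R F W : ℕ) : Rule C N :=
  { r with body := r.body.map (Lit.substBool R (guardExpr C N F W)) }

theorem Rule.consts_guard (r : Rule C N) (R F W : ℕ) : (r.guard R F W).consts = r.consts := by
  have hA : (guardExpr C N F W).consts = ∅ := Set.union_empty _
  ext c
  simp [Rule.consts, Lit.consts_substBool hA]

theorem Rule.syms_guard (r : Rule C N) (R F W : ℕ) : (r.guard R F W).syms = r.syms := by
  have hA : (guardExpr C N F W).syms = ∅ := Set.union_empty _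
  ext c
  simp [Rule.syms, Lit.syms_substBool hA]

theorem guardExpr_eval (I J : Interp U N) (s : State U) (F W : ℕ) :
    (guardExpr C N F W).eval I J s =
      ((s (.pred (.arr .iota .o)) F : ATy.sem U .iota → PTy.sem U .o) (s .iota W),
        (s (.pred (.arr .iota .o)) F : ATy.sem U .iota → PTy.sem U .o) (s .iota W)) :=
  Expr.eval_app_of_exact I J s _ rfl

/-- From left to right, `R` receives the value of `F W`; this leaves the head alone. Conversely, `F`
receives the constant function with the value of `R`, so the value of `W` is irrelevant. -/
theorem Rule.fires_guard {r : Rule C N} {R F W : ℕ} (hR : (ATy.pred .o, R) ∉ r.params.vars)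
    (hF : (ATy.pred (.arr .iota .o), F) ∉ r.vars) (b : Bool) (I J : Interp U N) (π : PTy)
    (p : N) (d : PTy.Tuple U π) :
    (r.guard R F W).Fires b I J π p d ↔ r.Fires b I J π p d := by
  by_cases hπ : (π, p) = (r.ty, r.name)
  swap
  · exact iff_of_false (fun hf => hπ hf.head_eq) fun hf => hπ hf.head_eq
  obtain ⟨rfl, rfl⟩ : π = r.ty ∧ p = r.name := Prod.mk.inj hπ
  refine (Rule.fires_mk b I J r.params r.nodup _ d).trans
    (Iff.trans ?_ (Rule.fires_mk b I J r.params r.nodup r.body d).symm)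
  simp only [sel_bodyEval, List.forall_mem_map]
  constructor
  · rintro ⟨s, rfl, hs⟩
    refine ⟨s.set (.pred .o) R _, Params.eval_congr _ fun v hv => State.set_of_ne _ _ fun e =>
      hR (e ▸ hv), fun L hL => (congrArg (sel b) (Lit.eval_substBool (guardExpr_eval I J s F W) L)).mp
        (hs L hL)⟩
  · rintro ⟨s, rfl, hs⟩
    obtain ⟨f, hf⟩ : ∃ f : ATy.sem U (.pred (.arr .iota .o)),
        ∀ a, (f : ATy.sem U .iota → PTy.sem U .o) a = s (.pred .o) R :=
      ⟨fun _ => s (.pred .o) R, fun _ => rfl⟩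
    set s' := s.set (.pred (.arr .iota .o)) F f with hs'
    have hss : ∀ v ∈ r.vars, s' v.1 v.2 = s v.1 v.2 := fun v hv => State.set_of_ne _ _ fun e =>
      hF (e ▸ hv)
    have hA : (guardExpr C N F W).eval I J s' = (s (.pred .o) R, s (.pred .o) R) := by
      have hv := (congrFun (State.set_self s (.pred (.arr .iota .o)) F f) (s' .iota W)).trans
        (hf _)
      exact (guardExpr_eval I J s' F W).trans (Prod.ext hv hv)
    refine ⟨s', Params.eval_congr _ fun v hv => hss v (Or.inl hv), fun L hL => ?_⟩
    rw [Lit.eval_substBool hA, Lit.eval_congr_state (s' := s)]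
    · exact hs L hL
    · rw [State.set_of_ne _ _ fun e => ATy.noConfusion (Prod.mk.inj e).1,
        hs', State.set_of_ne _ _ fun e => by cases (Prod.mk.inj e).1]
    · intro v hv
      by_cases hvR : (v.1, v.2) = (.pred .o, R)
      · obtain ⟨v₁, v₂⟩ := v
        cases hvR
        exact State.set_self ..
      · rw [State.set_of_ne _ _ hvR]
        exact hss v (Or.inr ⟨L, hL, hv⟩)

end Substitution

/-! ## Constants -/

section Constants

variable {C N : Type}

theorem Expr.finite_consts : ∀ {ρ : ATy} (E : Expr C N ρ), E.consts.Finite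
  | _, .var _ _ => Set.finite_empty
  | _, .cst c => Set.finite_singleton c
  | _, .sym _ _ => Set.finite_empty
  | _, .app E F => E.finite_consts.union F.finite_consts

theorem Lit.finite_consts (L : Lit C N) : L.consts.Finite := by
  cases L with
  | pos E => exact E.finite_consts
  | neg E => exact E.finite_consts
  | eq E F => exact E.finite_consts.union F.finite_consts
  | neq E F => exact E.finite_consts.union F.finite_consts

theorem Program.finite_consts (P : Program C N) : P.consts.Finite := by
  have : P.consts = ⋃ r ∈ (P : Set (Rule C N)), ⋃ L ∈ {L | L ∈ r.body}, L.consts := by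
    ext c
    simp [Program.consts, Rule.consts]
  rw [this]
  exact P.finite_toSet.biUnion fun r _ => (List.finite_toSet r.body).biUnion fun L _ =>
    L.finite_consts

theorem Expr.consts_apps (π' : PTy) : ∀ {π : PTy} (E : Expr C N (.pred (π.append π')))
    (X : Params π), (Expr.apps π' E X).consts = E.consts
  | _, _, .nil => rfl
  | .arr _ π, E, .cons _ X =>
    (Expr.consts_apps (π := π) π' (.app E (.var _ _)) X).trans (Set.union_empty _)

theorem Expr.consts_appAll : ∀ {π : PTy} (E : Expr C N (.pred π)) (X : Params π),
    (E.appAll X).consts = E.consts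
  | _, _, .nil => rfl
  | .arr _ _, E, .cons _ X =>
    (Expr.consts_appAll (.app E (.var _ _)) X).trans (Set.union_empty _)

theorem consts_eqLits (nm : AuxNames N) : ∀ {π : PTy} (Z Y : Params π),
    ∀ L ∈ eqLits nm Z Y, (L : Lit C N).consts = ∅
  | _, .nil, .nil, _, h => absurd h List.not_mem_nil
  | .arr _ _, .cons _ Z, .cons _ Y, L, h => by
    rcases List.mem_cons.1 h with rfl | h
    · simp [Lit.consts, Expr.consts]
    · exact consts_eqLits nm Z Y L h

theorem consts_eqRules (nm : AuxNames N) (ρ : ATy) :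
    ∀ r ∈ eqRules nm ρ, (r : Rule C N).consts = ∅ := by
  cases ρ <;>
    simp [eqRules, Rule.consts, Lit.consts, Expr.consts, Expr.consts_appAll]

/-- Among the new rules only `bodyRule` can contain individual constants, so the Herbrand universe
is unchanged. -/
theorem mem_consts_newRules {nm : AuxNames N} {r : Rule C N} {πR : PTy} {R : ℕ}
    {hR : (ATy.pred πR, R) ∉ r.params.vars} {c : C} :
    (∃ ρ ∈ newRules nm r πR R hR, c ∈ ρ.consts) ↔ c ∈ r.consts := by
  constructor
  · rintro ⟨ρ, hρ, hc⟩
    simp only [newRules, List.mem_append, List.mem_cons, List.not_mem_nil, or_false,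
      List.mem_flatMap] at hρ
    rcases hρ with ((rfl | rfl | rfl | rfl) | hρ) | ⟨ρ', -, hρ⟩
    · simp [Rule.consts, Lit.consts, Expr.consts, Expr.consts_apps] at hc
    · exact hc
    · simp [Rule.consts, Lit.consts, Expr.consts, Expr.consts_apps] at hc
    · simp [emptyRule, Rule.consts, Lit.consts, Expr.consts] at hc
    · simp only [addRules, List.mem_cons, List.not_mem_nil, or_false] at hρ
      rcases hρ with rfl | rfl
      · simp [Rule.consts, Lit.consts, Expr.consts, Expr.consts_appAll] at hc
      · obtain ⟨L, hL, hc⟩ := hc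
        rw [consts_eqLits nm _ _ L hL] at hc
        exact absurd hc (Set.notMem_empty c)
    · rw [consts_eqRules nm ρ' ρ hρ] at hc
      exact absurd hc (Set.notMem_empty c)
  · intro hc
    refine ⟨bodyRule nm r πR R hR, ?_, hc⟩
    simp [newRules, bodyRule]

theorem syms_argLits : ∀ (k : ℕ) (as : List C), ∀ L ∈ argLits k as, (L : Lit C N).syms = ∅
  | _, [], _, h => absurd h List.not_mem_nil
  | k, a :: as, L, h => by
    rcases List.mem_cons.1 h with rfl | h
    · simp [Lit.syms, Expr.syms]
    · exact syms_argLits (k + 1) as L h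

theorem GroundAtom.syms_toRule (a : GroundAtom C N) :
    a.toRule.syms = {(PTy.fo a.args.length, a.name)} := by
  ext q
  constructor
  · rintro (h | ⟨L, hL, hq⟩)
    · exact h
    · rw [syms_argLits 0 a.args L hL] at hq
      exact absurd hq (Set.notMem_empty q)
  · exact Or.inl

end Constants

/-! ## The theorem -/

section Main

variable {C N : Type} {σ₁ σ₂ : Schema N} {P : Program C N}

theorem Program.mem_addDatabase (D : Database C σ₁) (ρ : Rule C N) :
    ρ ∈ P.addDatabase D ↔ ρ ∈ P ∨ ∃ a ∈ D.1, a.toRule = ρ := by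
  classical
  simp [Program.addDatabase]

theorem Program.mem_replace {r : Rule C N} {l : List (Rule C N)} (ρ : Rule C N) :
    ρ ∈ P.replace r l ↔ (ρ ≠ r ∧ ρ ∈ P) ∨ ρ ∈ l := by
  classical
  simp [Program.replace]

/-- Interpretations of the two programs live over universes that are only propositionally equal.
Comparing derivations over an arbitrary finite `U` lets the equality be rewritten once, here. -/
theorem Program.defines_congr {P P' : Program C N}
    (hc : ∀ D : Database C σ₁, (P.addDatabase D).consts = (P'.addDatabase D).consts)
    (hd : ∀ (D : Database C σ₁) (U : Set C), Finite U → ∀ (p : N) (as : List U) (S : Reading),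
      (p, as.length) ∈ σ₂ → ((P.addDatabase D).DerivesIn U p as S ↔
        (P'.addDatabase D).DerivesIn U p as S))
    (S : Reading) (Q : Query C σ₁ σ₂) : P.Defines S Q ↔ P'.Defines S Q := by
  refine forall₂_congr fun D a => iff_congr Iff.rfl (and_congr_right fun ha => ?_)
  simp only [Program.derives_iff]
  rw [← hc D]
  refine exists_congr fun as => and_congr_right fun has => ?_
  refine hd D _ (P.addDatabase D).finite_consts a.name as S ?_
  rwa [← List.length_map (f := Subtype.val), has]

/-- Replacing a rule `r` that is equivalent to `r'` by the rules for `r'`. -/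
theorem Program.defines_replace {nm : AuxNames N} {r r' : Rule C N} (hr : r ∈ P) {πR : PTy}
    {R : ℕ} (hR : (ATy.pred πR, R) ∉ r'.params.vars)
    (hfresh : Disjoint (nm.syms r'.ty πR) (P.syms ∪ (σ₁.syms ∪ σ₂.syms)))
    (hconsts : r'.consts = r.consts) (hsyms : r'.syms = r.syms)
    (hfires : ∀ (U : Set C) (b : Bool) (I J : Interp U N) (π : PTy) (p : N)
      (d : PTy.Tuple U π), r'.Fires b I J π p d ↔ r.Fires b I J π p d)
    (S : Reading) (Q : Query C σ₁ σ₂) :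
    P.Defines S Q ↔ (P.replace r (newRules nm r' πR R hR)).Defines S Q := by
  classical
  refine Program.defines_congr (fun D => ?_) (fun D U _ p as S hp => ?_) S Q
  · ext c
    have hnew := mem_consts_newRules (nm := nm) (hR := hR) (c := c)
    rw [hconsts] at hnew
    constructor
    · rintro ⟨ρ, hρ, hc⟩
      rcases (Program.mem_addDatabase D ρ).1 hρ with hρ | hρ
      · by_cases hρr : ρ = r
        · subst hρr
          obtain ⟨ρ', hρ', hc⟩ := hnew.2 hc
          exact ⟨ρ', (Program.mem_addDatabase D ρ').2
            (Or.inl ((Program.mem_replace ρ').2 (Or.inr hρ'))), hc⟩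
        · exact ⟨ρ, (Program.mem_addDatabase D ρ).2
            (Or.inl ((Program.mem_replace ρ).2 (Or.inl ⟨hρr, hρ⟩))), hc⟩
      · exact ⟨ρ, (Program.mem_addDatabase D ρ).2 (Or.inr hρ), hc⟩
    · rintro ⟨ρ, hρ, hc⟩
      rcases (Program.mem_addDatabase D ρ).1 hρ with hρ | hρ
      · rcases (Program.mem_replace ρ).1 hρ with hρ | hρ
        · exact ⟨ρ, (Program.mem_addDatabase D ρ).2 (Or.inl hρ.2), hc⟩
        · exact ⟨r, (Program.mem_addDatabase D r).2 (Or.inl hr), hnew.1 ⟨ρ, hρ, hc⟩⟩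
      · exact ⟨ρ, (Program.mem_addDatabase D ρ).2 (Or.inr hρ), hc⟩
  · set B : Program C N := P.erase r ∪ D.1.image GroundAtom.toRule with hB
    have hmemB : ∀ ρ, ρ ∈ B ↔ (ρ ≠ r ∧ ρ ∈ P) ∨ ∃ a ∈ D.1, a.toRule = ρ := fun ρ => by
      simp [hB]
    have hT : IsTransformed nm r' πR R hR B
        ((P.replace r (newRules nm r' πR R hR)).addDatabase D) := by
      refine ⟨fun ρ => ?_, fun q hq => ⟨?_, fun hqr => ?_⟩⟩
      · rw [Program.mem_addDatabase, Program.mem_replace, hmemB]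
        exact or_right_comm
      · rintro ⟨ρ, hρ, hqρ⟩
        rcases (hmemB ρ).1 hρ with ⟨-, hρ⟩ | ⟨a, ha, rfl⟩
        · exact Set.disjoint_left.1 hfresh hq (Or.inl ⟨ρ, hρ, hqρ⟩)
        · rw [GroundAtom.syms_toRule] at hqρ
          exact Set.disjoint_left.1 hfresh hq (Or.inr (Or.inl ⟨_, D.2 a ha, hqρ⟩))
      · exact Set.disjoint_left.1 hfresh hq (Or.inl ⟨r, hr, hsyms ▸ hqr⟩)
    -- The program `insert r' B` is intermediate: its operator agrees with that of `P ∪ D`, as `r`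
    -- and `r'` fire alike, and it is the one whose rule `r'` gets transformed.
    have hins : ∀ ρ, ρ ∈ insert r' B ↔ ρ ∈ B ∨ ρ = r' := fun ρ => by
      rw [Finset.mem_insert, or_comm]
    rw [← hT.derivesIn_iff hins (fun hq =>
      Set.disjoint_left.1 hfresh hq (Or.inr (Or.inr ⟨_, hp, rfl⟩))) S]
    refine Program.derivesIn_congr (Program.approx_eq_of_fires fun b I J π p d => ?_) p as S
    -- The rule `r` may also be a fact of `D` and so remain in `B`; this is harmless.
    have hmem : ∀ ρ, ρ ∈ P.addDatabase D ↔ ρ ∈ B ∨ ρ = r := fun ρ => by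
      rw [Program.mem_addDatabase, hmemB]
      by_cases hρ : ρ = r
      · simp [hρ, hr]
      · simp [hρ]
    simp only [hmem, hins, or_and_right, exists_or, exists_eq_left, hfires]

end Main

end HODatalog

theorem mainTheorem4 {C N : Type} (σ₁ σ₂ : HODatalog.Schema N) (P P' : HODatalog.Program C N)
    (h : P.TransformsTo (σ₁.syms ∪ σ₂.syms) P')
    (S : HODatalog.Reading) (Q : HODatalog.Query C σ₁ σ₂) :
    P.Defines S Q ↔ P'.Defines S Q := by
  cases h with
  | direct nm r hr πR R hR hfresh =>
    exact HODatalog.Program.defines_replace hr hR hfresh rfl rfl (fun _ _ _ _ _ _ _ => Iff.rfl)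
      S Q
  | bool nm r hr R F W hR hF _ hfresh =>
    exact HODatalog.Program.defines_replace (r' := r.guard R F W) hr
      (fun h => hF (Or.inl h)) hfresh (r.consts_guard R F W)
      (r.syms_guard R F W) (fun _ => HODatalog.Rule.fires_guard hR hF) S Q
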